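/- Let $\Sigma$ be a finite complete polyhedral subdivision of $\mathbb{R}^n$ ($n\ge 0$). Let $C(\Sigma)$ be the fan in $\mathbb{R}^{n+1}$ consisting of the closed cones over $\sigma\times\{1\}$ (the cone over $\sigma \times\{1\}$ completed on level $0$ by $\mathrm{Rec}(\sigma)\times\{0\}$) and of the cones $\mathrm{Rec}(\sigma)\times\{0\}$, for $\sigma\in\Sigma$, where $\mathrm{Rec}(\sigma)$ is the recession cone of $\sigma$. Assume that $\Sigma$ is strongly unimodular: each cone of $C(\Sigma)$ is generated by a part of a basis of $\mathbb{Z}^{n+1}$, and the last coordinate of the primitive generator of each ray of $C(\Sigma)$ is $0$ or $1$. Let $\mathbb{C}\Sigma$ be the complex toric variety associated to $C(\Sigma)$, let $\pi\colon\mathbb{C}\Sigma\to\mathbb{C}$ be the toric morphism corresponding to the projection $\mathbb{R}^{n+1}\to\mathbb{R}$ to the last coordinate, and let $\iota\colon\mathbb{C}\Sigma\to\mathbb{C}\Sigma$ be the standard real structure (complex conjugation). Then $(\pi,\iota)$ is a totally real semi-stable degeneration, both over the base $B=\mathbb{C}$ and, after restriction to $\pi^{-1}(\mathcal{D})$, over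 the open unit disc $B=\mathcal{D}\subset\mathbb{C}$. That is, the complex analytic space $X=\mathbb{C}\Sigma$ (respectively its open part $X=\pi^{-1}(\mathcal{D})$) is a complex manifold of dimension $n+1$, and 1. $\pi\colon X\to B$ is proper and holomorphic; 2. $\pi$ is regular (its differential is surjective) at each point of $X \setminus X_0$, where $X_0=\pi^{-1}(0)$; 3. $X_0$ is a reduced normal crossing divisor: for each $p\in X_0$ there are $1\le k\le n+1$ and a holomorphic chart centred at $p$ in which $\pi(z)=z_1\cdots z_k$; 4. $\iota$ is an antiholomorphic involution of $X$ with $\mathrm{conj}\circ\pi=\pi\circ\iota$; 5. for each $p\in X_0$ with $\iota(p)=p$, the differential $d\iota\colon T_pX\to T_pX$ maps each hyperplane of the tangent cone $T_pX_0$ to itself; here $T_pX_0=\{z_1\cdots z_k=0\}$ with respect to a chart as in 3. -/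

import Mathlib

open scoped Manifold ContDiff ComplexConjugate

noncomputable section

/-! # Semi-stable degenerations -/

section Degenerations

variable {d : ℕ} {X : Type*} [TopologicalSpace X] [ChartedSpace (Fin d → ℂ) X]

/-- `X`, with its atlas, is a complex manifold of dimension `d`
(holomorphic transition functions, Hausdorff, second countable). -/
structure IsComplexManifold (d : ℕ) (X : Type*) [TopologicalSpace X]
    [ChartedSpace (Fin d → ℂ) X] : Prop where
  isManifold : IsManifold 𝓘(ℂ, Fin d → ℂ) ω X
  t2 : T2Space X
  secondCountable : SecondCountableTopology X

/-- `e` is a holomorphic normal crossing chart of type `(k, d)` for `π` at `p`: it is centred at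
`p`, and `π = z₁ ⋯ z_k` in the coordinates `z = e x`, where `1 ≤ k ≤ d`. -/
structure IsNormalCrossingChart (π : X → ℂ) (p : X) (k : ℕ)
    (e : OpenPartialHomeomorph X (Fin d → ℂ)) : Prop where
  mem_maximalAtlas : e ∈ IsManifold.maximalAtlas 𝓘(ℂ, Fin d → ℂ) ω X
  mem_source : p ∈ e.source
  centred : e p = 0
  one_le : 1 ≤ k
  le_dim : k ≤ d
  eq_prod : ∀ x ∈ e.source, π x = ∏ i : Fin d with i.val < k, e x i

/-- `π : X → B` is a complex semi-stable degeneration over the base `B ⊆ ℂ`, an open set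
containing `0` (the unit disc, or all of `ℂ`): `X` is a complex manifold, `π` is proper and
holomorphic, it is regular over `B \ {0}`, and the special fibre `π ⁻¹ {0}` is a reduced normal
crossing divisor, i.e. `π = z₁ ⋯ z_k` in suitable holomorphic coordinates centred at any of its
points. -/
structure IsSemistableDegeneration (d : ℕ) {X : Type*} [TopologicalSpace X]
    [ChartedSpace (Fin d → ℂ) X] (B : Set ℂ) (π : X → ℂ) : Prop where
  isComplexManifold : IsComplexManifold d X
  mapsTo : ∀ x, π x ∈ B
  holomorphic : ContMDiff 𝓘(ℂ, Fin d → ℂ) 𝓘(ℂ, ℂ) ω π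
  proper : ∀ K ⊆ B, IsCompact K → IsCompact (π ⁻¹' K)
  regular : ∀ x, π x ≠ 0 →
    Function.Surjective (mfderiv 𝓘(ℂ, Fin d → ℂ) 𝓘(ℂ, ℂ) π x)
  normalCrossing : ∀ p, π p = 0 →
    ∃ (k : ℕ) (e : OpenPartialHomeomorph X (Fin d → ℂ)), IsNormalCrossingChart π p k e

/-- `ι` is antiholomorphic: it is continuous, and the complex conjugates of its components in
local coordinates are holomorphic. -/
def IsAntiholomorphic (d : ℕ) {X : Type*} [TopologicalSpace X]
    [ChartedSpace (Fin d → ℂ) X] (ι : X → X) : Prop :=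
  Continuous ι ∧ ∀ p, ContMDiffAt 𝓘(ℂ, Fin d → ℂ) 𝓘(ℂ, Fin d → ℂ) ω
    (fun x => fun i => conj (chartAt (Fin d → ℂ) (ι p) (ι x) i)) p

/-- `ι` is a real structure for `π`: an antiholomorphic involution with `conj ∘ π = π ∘ ι`. -/
structure IsRealStructure (d : ℕ) {X : Type*} [TopologicalSpace X]
    [ChartedSpace (Fin d → ℂ) X] (π : X → ℂ) (ι : X → X) : Prop where
  antiholomorphic : IsAntiholomorphic d ι
  involutive : Function.Involutive ι
  conj_comp : ∀ x, conj (π x) = π (ι x)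

/-- The hyperplane `{v | d(z_i)(v) = 0}` of the tangent space at `q`, where `z_i` is the `i`-th
coordinate of the chart `e`. If `e` is a normal crossing chart of type `(k, d)` at `p`, then the
tangent cone at `p` of the special fibre is the union of these hyperplanes for the first `k`
coordinates. -/
def coordHyperplane (e : OpenPartialHomeomorph X (Fin d → ℂ)) (i : Fin d) (q : X) :
    Set (TangentSpace 𝓘(ℝ, Fin d → ℂ) q) :=
  {v | (mfderiv 𝓘(ℝ, Fin d → ℂ) 𝓘(ℝ, Fin d → ℂ) e q v : Fin d → ℂ) i = 0}

/-- `(π, ι)` is a totally real semi-stable degeneration over `B`: at each real point `p` of the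
special fibre, the (real) differential of `ι` maps each hyperplane of the tangent cone of the
special fibre onto itself. -/
structure IsTotallyRealSemistableDegeneration (d : ℕ) {X : Type*} [TopologicalSpace X]
    [ChartedSpace (Fin d → ℂ) X] (B : Set ℂ) (π : X → ℂ) (ι : X → X) : Prop where
  semistable : IsSemistableDegeneration d B π
  realStructure : IsRealStructure d π ι
  totallyReal : ∀ p, π p = 0 → ι p = p →
    ∀ (k : ℕ) (e : OpenPartialHomeomorph X (Fin d → ℂ)), IsNormalCrossingChart π p k e →
    ∀ i : Fin d, i.val < k →
      mfderiv 𝓘(ℝ, Fin d → ℂ) 𝓘(ℝ, Fin d → ℂ) ι p '' coordHyperplane e i p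
        = coordHyperplane e i (ι p)

end Degenerations

/-! # Polyhedral subdivisions -/

/-- A polyhedron in `ℝⁿ`: a finite intersection of closed half-spaces. -/
def IsPolyhedron {n : ℕ} (P : Set (Fin n → ℝ)) : Prop :=
  ∃ (k : ℕ) (a : Fin k → Fin n → ℝ) (b : Fin k → ℝ), P = {x | ∀ i, ∑ j, a i j * x j ≤ b i}

/-- A finite complete polyhedral subdivision of `ℝⁿ`. The faces of a polyhedron are its nonempty
exposed subsets (the sets of maximisers of a linear form). -/
structure PolyhedralSubdivision (n : ℕ) where
  cells : Set (Set (Fin n → ℝ))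
  finite : cells.Finite
  isPolyhedron : ∀ P ∈ cells, IsPolyhedron P
  nonempty : ∀ P ∈ cells, P.Nonempty
  face_mem : ∀ P ∈ cells, ∀ F : Set (Fin n → ℝ), F.Nonempty → IsExposed ℝ P F → F ∈ cells
  inter_face : ∀ P ∈ cells, ∀ Q ∈ cells, (P ∩ Q).Nonempty → IsExposed ℝ P (P ∩ Q)
  complete : ⋃₀ cells = Set.univ

/-- The recession cone of a polyhedron. -/
def recessionCone {n : ℕ} (P : Set (Fin n → ℝ)) : Set (Fin n → ℝ) :=
  {v | ∀ x ∈ P, x + v ∈ P}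

/-- The recession cone of `P`, placed in `ℝⁿ × {0} ⊆ ℝⁿ⁺¹`. -/
def levelZeroCone {n : ℕ} (P : Set (Fin n → ℝ)) : Set (Fin (n + 1) → ℝ) :=
  {y | y (Fin.last n) = 0 ∧ Fin.init y ∈ recessionCone P}

/-- The closed cone over `P × {1} ⊆ ℝⁿ⁺¹`: the cone over `P × {1}` completed on level `0` by the
recession cone of `P`. -/
def coneOver {n : ℕ} (P : Set (Fin n → ℝ)) : Set (Fin (n + 1) → ℝ) :=
  {y | 0 < y (Fin.last n) ∧ (y (Fin.last n))⁻¹ • (Fin.init y : Fin n → ℝ) ∈ P} ∪ levelZeroCone P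

/-- A cone in `ℝᴺ` is unimodular if it is generated by a part of a lattice basis of `ℤᴺ`. -/
def IsUnimodularCone {N : ℕ} (τ : Set (Fin N → ℝ)) : Prop :=
  ∃ (b : Module.Basis (Fin N) ℤ (Fin N → ℤ)) (s : Set (Fin N)),
    τ = {y | ∃ t : Fin N → ℝ, (∀ i, 0 ≤ t i) ∧ (∀ i, i ∉ s → t i = 0) ∧
      ∀ j, y j = ∑ i, t i * (b i j : ℝ)}

/-- `u` is the primitive generator of the ray `ρ`. -/
def IsPrimitiveGenerator {N : ℕ} (u : Fin N → ℤ) (ρ : Set (Fin N → ℝ)) : Prop :=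
  (∀ k : ℤ, (∀ i, k ∣ u i) → IsUnit k) ∧
    ρ = {y | ∃ t : ℝ, 0 ≤ t ∧ ∀ i, y i = t * (u i : ℝ)}

namespace PolyhedralSubdivision

variable {n : ℕ} (S : PolyhedralSubdivision n)

/-- The fan `C(Σ)` in `ℝⁿ⁺¹`: the cones over `σ × {1}`, for the cells `σ` of `Σ`, together with
the recession fan of `Σ` on level `0`. -/
def fan : Set (Set (Fin (n + 1) → ℝ)) :=
  {τ | ∃ P ∈ S.cells, τ = coneOver P ∨ τ = levelZeroCone P}

/-- `Σ` is unimodular if all cones of `C(Σ)` are. -/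
def IsUnimodular : Prop := ∀ τ ∈ S.fan, IsUnimodularCone τ

/-- `Σ` is strongly unimodular if it is unimodular and the primitive generator of each ray of
`C(Σ)` has last coordinate `0` or `1`. -/
def IsStronglyUnimodular : Prop :=
  S.IsUnimodular ∧ ∀ ρ ∈ S.fan, ∀ u : Fin (n + 1) → ℤ, IsPrimitiveGenerator u ρ →
    u (Fin.last n) = 0 ∨ u (Fin.last n) = 1

end PolyhedralSubdivision

/-! # The toric variety of `C(Σ)` -/

/-- The semigroup `τ^∨ ∩ ℤᴺ` of integral linear forms that are nonnegative on `τ`. -/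
def dualSemigroup {N : ℕ} (τ : Set (Fin N → ℝ)) : AddSubmonoid (Fin N → ℤ) where
  carrier := {m | ∀ y ∈ τ, 0 ≤ ∑ i, (m i : ℝ) * y i}
  zero_mem' := by intro y _; simp
  add_mem' := by
    intro a b ha hb y hy
    have := add_nonneg (ha y hy) (hb y hy)
    simpa [add_mul, Finset.sum_add_distrib] using this

theorem dualSemigroup_anti {N : ℕ} {τ' τ : Set (Fin N → ℝ)} (h : τ' ⊆ τ) :
    dualSemigroup τ ≤ dualSemigroup τ' := fun _ hm y hy => hm y (h hy)

/-- The affine toric variety `U_τ` over `ℂ`, as the space of semigroup homomorphisms from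
`τ^∨ ∩ ℤᴺ` to `(ℂ, ·)`, with the topology of pointwise convergence (its classical topology). -/
abbrev AffineToric {N : ℕ} (τ : Set (Fin N → ℝ)) : Type :=
  {φ : dualSemigroup τ → ℂ // φ 0 = 1 ∧ ∀ a b, φ (a + b) = φ a * φ b}

/-- Complex conjugation on the affine chart `U_τ`. -/
def affineConj {N : ℕ} {τ : Set (Fin N → ℝ)} (φ : AffineToric τ) : AffineToric τ :=
  ⟨fun m => conj (φ.1 m), by simp [φ.2.1], fun a b => by simp [φ.2.2]⟩

namespace PolyhedralSubdivision

variable {n : ℕ} (S : PolyhedralSubdivision n)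

/-- For cones `τ' ⊆ τ` of the fan, `ψ ∈ U_τ'` is glued to its image (its restriction) in `U_τ`. -/
def Glue (a b : Σ τ : S.fan, AffineToric τ.1) : Prop :=
  ∃ h : a.1.1 ⊆ b.1.1, ∀ m : dualSemigroup b.1.1,
    b.2.1 m = a.2.1 ⟨m.1, dualSemigroup_anti h m.2⟩

/-- The complex toric variety `ℂΣ` associated with the fan `C(Σ)`: the affine toric varieties
`U_τ`, `τ ∈ C(Σ)`, glued along `U_τ' ⊆ U_τ` for `τ' ⊆ τ`, with the quotient topology. -/
abbrev ToricVariety : Type := Quot S.Glue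

/-- The point of the toric variety that is given by a point of the chart `U_τ`. -/
def toricMk (τ : S.fan) (φ : AffineToric τ.1) : S.ToricVariety := Quot.mk S.Glue ⟨τ, φ⟩

/-- The complex analytic structure of the toric variety: `f` is holomorphic at `x` if near `x`,
in some affine chart `U_τ` containing `x`, it is a holomorphic function of finitely many
monomial functions `φ ↦ φ m`, `m ∈ τ^∨ ∩ ℤⁿ⁺¹`. -/
def IsToricHolomorphicAt (f : S.ToricVariety → ℂ) (x : S.ToricVariety) : Prop :=
  ∃ (τ : S.fan) (φ : AffineToric τ.1) (r : ℕ) (m : Fin r → dualSemigroup τ.1)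
    (F : (Fin r → ℂ) → ℂ),
    S.toricMk τ φ = x ∧ AnalyticAt ℂ F (fun j => φ.1 (m j)) ∧
      ∀ᶠ ψ in nhds φ, f (S.toricMk τ ψ) = F (fun j => ψ.1 (m j))

theorem last_nonneg {τ : Set (Fin (n + 1) → ℝ)} (hτ : τ ∈ S.fan) {y : Fin (n + 1) → ℝ}
    (hy : y ∈ τ) : 0 ≤ y (Fin.last n) := by
  obtain ⟨P, -, rfl | rfl⟩ := hτ
  · rcases hy with hy | hy
    · exact hy.1.le
    · exact hy.1.ge
  · exact hy.1.ge

/-- The projection to the last coordinate, as an element of `τ^∨ ∩ ℤⁿ⁺¹` for `τ ∈ C(Σ)`. -/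
def lastForm (τ : S.fan) : dualSemigroup τ.1 :=
  ⟨Pi.single (Fin.last n) 1, fun y hy => by
    have h := S.last_nonneg τ.2 hy
    simpa [Pi.single_apply] using h⟩

/-- The toric morphism `π : ℂΣ → ℂ` of the projection to the last coordinate. -/
def toricProj : S.ToricVariety → ℂ :=
  Quot.lift (fun a => a.2.1 (S.lastForm a.1)) (by
    rintro a b ⟨h, hab⟩
    exact (hab (S.lastForm b.1)).symm)

/-- The standard real structure of the toric variety: complex conjugation of the values of
semigroup homomorphisms. -/
def toricConj : S.ToricVariety → S.ToricVariety :=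
  Quot.lift (fun a => S.toricMk a.1 (affineConj a.2)) (by
    rintro a b ⟨h, hab⟩
    exact Quot.sound ⟨h, fun m => congrArg conj (hab m)⟩)

theorem toricProj_toricConj (x : S.ToricVariety) :
    S.toricProj (S.toricConj x) = conj (S.toricProj x) := by
  induction x using Quot.ind
  rfl

theorem continuous_toricProj : Continuous S.toricProj := by
  refine continuous_quot_lift _ (continuous_sigma fun τ => ?_)
  exact (continuous_apply (S.lastForm τ)).comp continuous_subtype_val

/-- The part of the toric variety over the open unit disc. -/
def overDisc : TopologicalSpace.Opens S.ToricVariety :=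
  ⟨S.toricProj ⁻¹' Metric.ball 0 1, Metric.isOpen_ball.preimage S.continuous_toricProj⟩

/-- The restriction of `π` to the part over the open unit disc. -/
def discProj (x : S.overDisc) : ℂ := S.toricProj x.1

/-- The restriction of the real structure to the part over the open unit disc. -/
def discConj (x : S.overDisc) : S.overDisc :=
  ⟨S.toricConj x.1, by
    have h : S.toricProj x.1 ∈ Metric.ball (0 : ℂ) 1 := x.2
    change S.toricProj (S.toricConj x.1) ∈ Metric.ball (0 : ℂ) 1
    rw [toricProj_toricConj]
    simpa using h⟩

end PolyhedralSubdivision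

end

noncomputable section

/-! # Recession cones -/

section Recession

variable {n : ℕ} {P Q : Set (Fin n → ℝ)}

/-! The dual of a lattice basis adapted to a cone `τ` identifies `U_τ` with the open subset of
affine space where the coordinates outside the generating part do not vanish (`coordHomeomorph`),
and the changes of chart are Laurent monomials (`toricChart_eq_monomial`). There `toricConj` is
coordinatewise conjugation and `toricProj` is `∏ z_i ^ c_i`, with `c_i` the last coordinate of the
`i`-th basis vector. A coordinate with a zero belongs to a generator of `τ`, so its exponent is `0`
or `1` (`gen_last`). The other factors form a unit, which is absorbed into one vanishing coordinate;
the result is a normal crossing chart that is real at real points. Off the special fibre, moving a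
single coordinate shows regularity.

Gluing these charts to a Hausdorff manifold requires `C(Σ)` to be a fan. Above level `0` this is the
face condition on cells. On level `0` it concerns recession cones of cells that may be disjoint, and
`mem_recessionCone_of_segment` deduces it from completeness and the connectedness of `ℝⁿ`. It
follows that cones of the fan intersect in cones of the fan (`inter_mem_fan`) and, by Farkas' lemma,
that integral forms separate them (`exists_separating`). Separating forms make `fractionGraph`
invariant under gluing, so that the charts inject, and they prove Hausdorffness.

Properness is again completeness of the fan. In logarithmic coordinates a torus point `y` with `‖π‖
≤ R` has `log R • e - y` in the upper half-space, `e` being the last unit vector, hence in some cone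
`σ`; this bounds every monomial of `σ^∨` (`mem_boundedPart_of_ne_zero`). Finitely many compact sets
therefore contain these torus points, and a limit argument gives the remaining points.

For total reality, each tangent hyperplane seen in one normal crossing chart is a coordinate
hyperplane of any other (`exists_same_hyperplane`), so one real chart at each real point suffices.
The disc case is restriction to an open subset. -/

theorem zero_mem_recessionCone : (0 : Fin n → ℝ) ∈ recessionCone P := fun x hx => by simpa using hx

theorem add_mem_recessionCone {v w : Fin n → ℝ} (hv : v ∈ recessionCone P)
    (hw : w ∈ recessionCone P) : v + w ∈ recessionCone P := fun x hx => by
  rw [← add_assoc]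
  exact hw _ (hv _ hx)

/-- Iterating a recession direction stays in the polyhedron, so no defining form can grow along it.
Nonemptiness matters: the recession cone of the empty set is everything. -/
theorem mem_recessionCone_setOf_iff {k : ℕ} {a : Fin k → Fin n → ℝ} {b : Fin k → ℝ}
    (hP : {x : Fin n → ℝ | ∀ i, ∑ j, a i j * x j ≤ b i}.Nonempty) {v : Fin n → ℝ} :
    v ∈ recessionCone {x : Fin n → ℝ | ∀ i, ∑ j, a i j * x j ≤ b i} ↔ ∀ i, a i ⬝ᵥ v ≤ 0 := by
  constructor
  · obtain ⟨x, hx⟩ := hP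
    intro hv i
    by_contra! h
    have key : ∀ m : ℕ, x + (m : ℝ) • v ∈ {x : Fin n → ℝ | ∀ i, ∑ j, a i j * x j ≤ b i} := by
      intro m
      induction m with
      | zero => simpa using hx
      | succ m ih =>
        have := hv _ ih
        rwa [add_assoc, show (m : ℝ) • v + v = ((m + 1 : ℕ) : ℝ) • v by
          rw [Nat.cast_succ, add_smul, one_smul]] at this
    obtain ⟨m, hm⟩ := exists_nat_gt ((b i - a i ⬝ᵥ x) / (a i ⬝ᵥ v))
    have h1 : a i ⬝ᵥ (x + (m : ℝ) • v) ≤ b i := key m i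
    rw [dotProduct_add, dotProduct_smul, smul_eq_mul] at h1
    rw [div_lt_iff₀ h] at hm
    linarith
  · intro hv x hx i
    have h1 : a i ⬝ᵥ x ≤ b i := hx i
    change a i ⬝ᵥ (x + v) ≤ b i
    rw [dotProduct_add]
    linarith [hv i]

namespace IsPolyhedron

theorem isClosed (hP : IsPolyhedron P) : IsClosed P := by
  obtain ⟨k, a, b, rfl⟩ := hP
  simp only [Set.ofPred_forall]
  exact isClosed_iInter fun i => isClosed_le (by fun_prop) continuous_const

theorem smul_mem_recessionCone (hP : IsPolyhedron P) (hne : P.Nonempty) {v : Fin n → ℝ}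
    (hv : v ∈ recessionCone P) {t : ℝ} (ht : 0 ≤ t) : t • v ∈ recessionCone P := by
  obtain ⟨k, a, b, rfl⟩ := hP
  rw [mem_recessionCone_setOf_iff hne] at hv ⊢
  intro i
  rw [dotProduct_smul, smul_eq_mul]
  exact mul_nonpos_of_nonneg_of_nonpos ht (hv i)

/-- A form increasing along `v` would eventually exceed its bound for good. Asking only for
unboundedly many times allows a pigeonhole over finitely many cells. -/
theorem mem_recessionCone_of_frequently (hP : IsPolyhedron P) {x v : Fin n → ℝ}
    (h : ∃ᶠ t : ℝ in Filter.atTop, x + t • v ∈ P) : v ∈ recessionCone P := by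
  have hne : P.Nonempty := by
    obtain ⟨t, ht⟩ := h.exists
    exact ⟨_, ht⟩
  obtain ⟨k, a, b, rfl⟩ := hP
  rw [mem_recessionCone_setOf_iff hne]
  intro i
  by_contra! hi
  obtain ⟨t, h1, h2⟩ :=
    (h.and_eventually (Filter.eventually_gt_atTop ((b i - a i ⬝ᵥ x) / (a i ⬝ᵥ v)))).exists
  have h3 : a i ⬝ᵥ (x + t • v) ≤ b i := h1 i
  rw [dotProduct_add, dotProduct_smul, smul_eq_mul] at h3
  rw [div_lt_iff₀ hi] at h2
  linarith

theorem eventually_mem_of_mem_recessionCone (hP : IsPolyhedron P) {x v : Fin n → ℝ} {t₀ : ℝ}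
    (h : x + t₀ • v ∈ P) (hv : v ∈ recessionCone P) : ∀ t ≥ t₀, x + t • v ∈ P := by
  intro t ht
  have := hP.smul_mem_recessionCone ⟨_, h⟩ hv (sub_nonneg.2 ht) _ h
  rwa [add_assoc, ← add_smul, add_sub_cancel] at this

/-- The starting points from which a ray in a recession direction ends up in `P` form a closed
set. -/
theorem isClosed_setOf_exists_ray (hP : IsPolyhedron P) {v : Fin n → ℝ}
    (hv : v ∈ recessionCone P) : IsClosed {z : Fin n → ℝ | ∃ t : ℝ, z + t • v ∈ P} := by
  rcases P.eq_empty_or_nonempty with rfl | hne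
  · simp
  obtain ⟨k, a, b, rfl⟩ := hP
  have hv' := (mem_recessionCone_setOf_iff hne).1 hv
  -- A constraint with `a i ⬝ᵥ v < 0` holds eventually along the ray; only those with `a i ⬝ᵥ v = 0`
  -- restrict the starting point.
  have : {z : Fin n → ℝ | ∃ t : ℝ, z + t • v ∈ {x : Fin n → ℝ | ∀ i, ∑ j, a i j * x j ≤ b i}}
      = {z | ∀ i, a i ⬝ᵥ v = 0 → a i ⬝ᵥ z ≤ b i} := by
    ext z
    constructor
    · rintro ⟨t, ht⟩ i hi
      have h1 : a i ⬝ᵥ (z + t • v) ≤ b i := ht i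
      rwa [dotProduct_add, dotProduct_smul, hi, smul_zero, add_zero] at h1
    · intro hz
      have h1 : ∀ i, ∃ T : ℝ, ∀ t ≥ T, a i ⬝ᵥ (z + t • v) ≤ b i := by
        intro i
        rcases (hv' i).eq_or_lt with h0 | h0
        · refine ⟨0, fun t _ => ?_⟩
          rw [dotProduct_add, dotProduct_smul, h0, smul_zero, add_zero]
          exact hz i h0
        · refine ⟨(b i - a i ⬝ᵥ z) / (a i ⬝ᵥ v), fun t ht => ?_⟩
          rw [dotProduct_add, dotProduct_smul, smul_eq_mul]
          rw [ge_iff_le, div_le_iff_of_neg h0] at ht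
          linarith
      choose T hT using h1
      obtain ⟨M, hM⟩ := (Set.finite_range T).bddAbove
      exact ⟨M, fun i => hT i M (hM ⟨i, rfl⟩)⟩
  rw [this]
  simp only [Set.ofPred_forall]
  refine isClosed_iInter fun i => isClosed_iInter fun _ => ?_
  exact isClosed_le (by unfold dotProduct; fun_prop) continuous_const

end IsPolyhedron

end Recession

/-! ### Compatibility of the recession cones of different cells -/

namespace PolyhedralSubdivision

variable {n : ℕ} (S : PolyhedralSubdivision n)

/-- Every ray eventually stays in a single cell. -/
theorem exists_cell_ray (z v : Fin n → ℝ) :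
    ∃ C ∈ S.cells, v ∈ recessionCone C ∧ ∃ t : ℝ, z + t • v ∈ C := by
  have h : ∃ᶠ t : ℝ in Filter.atTop, ∃ C ∈ S.cells, z + t • v ∈ C := by
    refine (Filter.Eventually.of_forall fun t => ?_).frequently
    have : z + t • v ∈ ⋃₀ S.cells := by rw [S.complete]; trivial
    simpa using this
  -- Pigeonhole: if the ray eventually left each of the finitely many cells, it would eventually lie
  -- in none.
  by_contra! hcon
  have h2 : ∀ C ∈ S.cells, ∀ᶠ t : ℝ in Filter.atTop, z + t • v ∉ C := by
    intro C hC
    by_contra hf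
    have hf' : ∃ᶠ t : ℝ in Filter.atTop, z + t • v ∈ C := by
      simpa [Filter.Frequently] using hf
    obtain ⟨t, ht⟩ := hf'.exists
    exact hcon C hC ((S.isPolyhedron C hC).mem_recessionCone_of_frequently hf') t ht
  have h3 := (Set.Finite.eventually_all S.finite).2 h2
  obtain ⟨t, ⟨C, hC, ht⟩, ht'⟩ := (h.and_eventually h3).exists
  exact ht' C hC ht

variable {S} in
-- The form exposing `C ∩ D` is maximal on `C` at both `z` and `z + v`, so it kills `v`; it is
-- nonpositive on `v + w` and `v - w`, so it kills `w` as well. The rays from `z` in these two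
-- directions thus stay in `C ∩ D`.
theorem mem_recessionCone_of_segment_aux {C D : Set (Fin n → ℝ)} (hC : C ∈ S.cells)
    (hD : D ∈ S.cells) {z v w : Fin n → ℝ} (hzC : z ∈ C) (hzD : z ∈ D)
    (hvC : v ∈ recessionCone C) (hvD : v ∈ recessionCone D)
    (h1 : v + w ∈ recessionCone C) (h2 : v - w ∈ recessionCone C) :
    v + w ∈ recessionCone D ∧ v - w ∈ recessionCone D := by
  obtain ⟨l, hl⟩ := S.inter_face C hC D hD ⟨z, hzC, hzD⟩ ⟨z, hzC, hzD⟩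
  have hz : z ∈ C ∩ D := ⟨hzC, hzD⟩
  have hzv : z + v ∈ C ∩ D := ⟨hvC z hzC, hvD z hzD⟩
  have hmax : ∀ y ∈ C, l y ≤ l z := by rw [hl] at hz; exact hz.2
  have hmax' : ∀ y ∈ C, l y ≤ l (z + v) := by rw [hl] at hzv; exact hzv.2
  have e1 := hmax _ hzv.1
  have e2 := hmax' _ hzC
  have e3 := hmax _ (h1 z hzC)
  have e4 := hmax _ (h2 z hzC)
  simp only [map_add, map_sub] at e1 e2 e3 e4
  have hv0 : l v = 0 := by linarith
  have hw0 : l w = 0 := by linarith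
  have key : ∀ y ∈ recessionCone C, l y = 0 → y ∈ recessionCone D := by
    intro y hy hy0
    refine (S.isPolyhedron D hD).mem_recessionCone_of_frequently (x := z) ?_
    refine ((Filter.eventually_ge_atTop 0).mono fun t ht => ?_).frequently
    have h4 := (S.isPolyhedron C hC).smul_mem_recessionCone ⟨z, hzC⟩ hy ht z hzC
    have h5 : z + t • y ∈ C ∩ D := by
      rw [hl]
      refine ⟨h4, fun y' hy' => ?_⟩
      rw [map_add, map_smul, hy0, smul_zero, add_zero]
      exact hmax y' hy'
    exact h5.2
  exact ⟨key _ h1 (by rw [map_add, hv0, hw0, add_zero]),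
    key _ h2 (by rw [map_sub, hv0, hw0, sub_zero])⟩

variable {S} in
-- Since `P` and `Q` may be disjoint, the face condition cannot be applied to them directly. The
-- starting points of `v`-rays that end up in a given cell form closed sets covering `ℝⁿ`. By
-- connectedness, a cell satisfying the conclusion and one violating it share such a starting point,
-- hence a point far along the ray, where the preceding lemma applies.
theorem mem_recessionCone_of_segment {P Q : Set (Fin n → ℝ)} (hP : P ∈ S.cells)
    (hQ : Q ∈ S.cells) {v w : Fin n → ℝ} (hvP : v ∈ recessionCone P) (hvQ : v ∈ recessionCone Q)
    (h1 : v + w ∈ recessionCone P) (h2 : v - w ∈ recessionCone P) :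
    v + w ∈ recessionCone Q ∧ v - w ∈ recessionCone Q := by
  obtain ⟨x, hx⟩ := S.nonempty P hP
  obtain ⟨y, hy⟩ := S.nonempty Q hQ
  let good : Set (Set (Fin n → ℝ)) :=
    {C | C ∈ S.cells ∧ v ∈ recessionCone C ∧ v + w ∈ recessionCone C ∧ v - w ∈ recessionCone C}
  let bad : Set (Set (Fin n → ℝ)) := {C | C ∈ S.cells ∧ v ∈ recessionCone C ∧ C ∉ good}
  let R : Set (Fin n → ℝ) → Set (Fin n → ℝ) := fun C => {z | ∃ t : ℝ, z + t • v ∈ C}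
  have hRg : IsClosed (⋃ C ∈ good, R C) :=
    (S.finite.subset fun C hC => hC.1).isClosed_biUnion fun C hC =>
      (S.isPolyhedron C hC.1).isClosed_setOf_exists_ray hC.2.1
  have hRb : IsClosed (⋃ C ∈ bad, R C) :=
    (S.finite.subset fun C hC => hC.1).isClosed_biUnion fun C hC =>
      (S.isPolyhedron C hC.1).isClosed_setOf_exists_ray hC.2.1
  by_contra hcon
  have hQbad : Q ∈ bad := ⟨hQ, hvQ, fun h => hcon h.2.2⟩
  have hcov : (Set.univ : Set (Fin n → ℝ)) ⊆ (⋃ C ∈ good, R C) ∪ ⋃ C ∈ bad, R C := by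
    intro z _
    obtain ⟨C, hC, hvC, ht⟩ := S.exists_cell_ray z v
    by_cases hg : C ∈ good
    · exact Or.inl (Set.mem_biUnion hg ht)
    · exact Or.inr (Set.mem_biUnion (⟨hC, hvC, hg⟩ : C ∈ bad) ht)
  obtain ⟨z, -, hz1, hz2⟩ := isPreconnected_closed_iff.1 isPreconnected_univ _ _ hRg hRb hcov
    ⟨x, trivial, Set.mem_biUnion (⟨hP, hvP, h1, h2⟩ : P ∈ good) ⟨0, by simpa using hx⟩⟩
    ⟨y, trivial, Set.mem_biUnion hQbad ⟨0, by simpa using hy⟩⟩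
  simp only [Set.mem_iUnion] at hz1 hz2
  obtain ⟨C, hC, t, ht⟩ := hz1
  obtain ⟨D, hD, t', ht'⟩ := hz2
  refine hD.2.2 ⟨hD.1, hD.2.1, ?_⟩
  exact mem_recessionCone_of_segment_aux hC.1 hD.1
    ((S.isPolyhedron C hC.1).eventually_mem_of_mem_recessionCone ht hC.2.1 _ (le_max_left t t'))
    ((S.isPolyhedron D hD.1).eventually_mem_of_mem_recessionCone ht' hD.2.1 _ (le_max_right t t'))
    hC.2.1 hD.2.1 hC.2.2.1 hC.2.2.2

variable {S} in
/-- The intersection of two recession cones is extreme in either of them. -/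
theorem mem_recessionCone_of_add_mem {P Q : Set (Fin n → ℝ)} (hP : P ∈ S.cells)
    (hQ : Q ∈ S.cells) {y y' : Fin n → ℝ} (hy : y ∈ recessionCone P) (hy' : y' ∈ recessionCone P)
    (h : y + y' ∈ recessionCone Q) : y ∈ recessionCone Q := by
  -- The segment has midpoint `y + y'` and half-length vector `y'`, so one of its endpoints is `y`.
  have h3 := mem_recessionCone_of_segment hP hQ (add_mem_recessionCone hy hy') h (w := y')
      (add_mem_recessionCone (add_mem_recessionCone hy hy') hy') (by rwa [add_sub_cancel_right])
  rw [add_sub_cancel_right] at h3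
  exact h3.2

end PolyhedralSubdivision

/-! # A theorem of alternatives -/

/-- Farkas' lemma over an ordered field. -/
theorem LinearMap.exists_nonneg_combination {K V : Type*} [Field K] [LinearOrder K]
    [IsStrictOrderedRing K] [AddCommGroup V] [Module K V] {m : ℕ} :
    ∀ (a : Fin m → V →ₗ[K] K) (b : V →ₗ[K] K), (∀ x, (∀ k, a k x ≤ 0) → b x ≤ 0) →
      ∃ t : Fin m → K, (∀ k, 0 ≤ t k) ∧ b = ∑ k, t k • a k := by
  induction m with
  | zero =>
    intro a b h
    refine ⟨0, fun k => k.elim0, ?_⟩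
    ext x
    have h1 := h x fun k => k.elim0
    have h2 := h (-x) fun k => k.elim0
    simp only [map_neg] at h2
    simp only [Finset.univ_eq_empty, Finset.sum_empty, LinearMap.zero_apply]
    linarith
  | succ m ih =>
    intro a b h
    -- If the last constraint is redundant, it gets coefficient `0`. Otherwise some `x₀` violates
    -- it, and the induction is applied after projecting along `x₀` onto its kernel.
    by_cases hb : ∀ x, (∀ k : Fin m, a k.castSucc x ≤ 0) → b x ≤ 0
    · obtain ⟨t, ht, hbt⟩ := ih (fun k => a k.castSucc) b hb
      refine ⟨Fin.snoc t 0, fun k => ?_, ?_⟩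
      · refine Fin.lastCases ?_ (fun k => ?_) k
        · simp
        · simpa using ht k
      · rw [Fin.sum_univ_castSucc]
        simpa using hbt
    · push Not at hb
      obtain ⟨x₀, hx₀, hbx₀⟩ := hb
      have hc : 0 < a (Fin.last m) x₀ := by
        by_contra! hc
        refine hbx₀.not_ge (h x₀ fun k => ?_)
        exact Fin.lastCases hc hx₀ k
      set c := a (Fin.last m) x₀
      let pr : V →ₗ[K] V := LinearMap.id - (LinearMap.toSpanSingleton K V (c⁻¹ • x₀)).comp
        (a (Fin.last m))
      have hpr : ∀ x, pr x = x - (a (Fin.last m) x * c⁻¹) • x₀ := by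
        intro x
        simp [pr, mul_smul]
      obtain ⟨t, ht, hbt⟩ := ih (fun k => (a k.castSucc).comp pr) (b.comp pr) (by
        intro x hx
        refine h (pr x) fun k => ?_
        refine Fin.lastCases ?_ hx k
        rw [hpr, map_sub, map_smul, smul_eq_mul, mul_assoc, inv_mul_cancel₀ hc.ne', mul_one,
          sub_self])
      -- The last coefficient is forced by evaluating the desired identity at `x₀`.
      refine ⟨Fin.snoc t (c⁻¹ * (b x₀ - ∑ k, t k * a k.castSucc x₀)), fun k => ?_, ?_⟩
      · refine Fin.lastCases ?_ (fun k => ?_) k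
        · have : ∑ k, t k * a k.castSucc x₀ ≤ 0 :=
            Finset.sum_nonpos fun k _ => mul_nonpos_of_nonneg_of_nonpos (ht k) (hx₀ k)
          rw [Fin.snoc_last]
          have : 0 ≤ b x₀ - ∑ k, t k * a k.castSucc x₀ := by linarith
          positivity
        · simpa using ht k
      · ext x
        have h1 := LinearMap.congr_fun hbt x
        simp only [LinearMap.comp_apply, LinearMap.sum_apply, LinearMap.smul_apply, hpr, map_sub,
          map_smul, smul_eq_mul, mul_sub, Finset.sum_sub_distrib] at h1
        rw [Fin.sum_univ_castSucc]
        simp only [Fin.snoc_castSucc, Fin.snoc_last, LinearMap.add_apply, LinearMap.sum_apply,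
          LinearMap.smul_apply, smul_eq_mul]
        have h2 : ∑ k, t k * (a (Fin.last m) x * c⁻¹ * a k.castSucc x₀)
            = a (Fin.last m) x * c⁻¹ * ∑ k, t k * a k.castSucc x₀ := by
          rw [Finset.mul_sum]
          exact Finset.sum_congr rfl fun k _ => by ring
        rw [h2] at h1
        linear_combination h1

/-- Either some integral linear form is nonnegative on the finite family `w` and positive on
`w k`, or `-w k` is a nonnegative combination of the family. -/
theorem exists_int_form_or_neg_mem_cone {N : ℕ} {ι : Type*} [Fintype ι] (w : ι → Fin N → ℤ)
    (k : ι) : (∃ u : Fin N → ℤ, (∀ l, 0 ≤ u ⬝ᵥ w l) ∧ 0 < u ⬝ᵥ w k) ∨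
      ∃ t : ι → ℝ, (∀ l, 0 ≤ t l) ∧ ∀ j, -(w k j : ℝ) = ∑ l, t l * (w l j : ℝ) := by
  let ev : (Fin N → ℤ) → (Fin N → ℚ) →ₗ[ℚ] ℚ := fun v =>
    Fintype.linearCombination ℚ (fun j => (v j : ℚ))
  have hev : ∀ v x, ev v x = ∑ j, x j * (v j : ℚ) := fun v x => by
    simp [ev, Fintype.linearCombination_apply]
  let e := Fintype.equivFin ι
  -- Farkas is used over `ℚ`, so that a witness for failure becomes integral after clearing
  -- denominators.
  by_cases hcase : ∀ x, (∀ l, (-ev (w (e.symm l))) x ≤ 0) → (ev (w k)) x ≤ 0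
  · right
    obtain ⟨t, ht, hbt⟩ := LinearMap.exists_nonneg_combination _ _ hcase
    refine ⟨fun l => (t (e l) : ℝ), fun l => Rat.cast_nonneg.2 (ht _), fun j => ?_⟩
    have h1 := LinearMap.congr_fun hbt (Pi.single j 1)
    simp only [hev, LinearMap.sum_apply, LinearMap.smul_apply, LinearMap.neg_apply, Pi.single_apply,
      ite_mul, one_mul, zero_mul, Finset.sum_ite_eq', Finset.mem_univ, if_true, smul_eq_mul,
      mul_neg, Finset.sum_neg_distrib] at h1
    rw [← e.sum_comp] at h1
    simp only [Equiv.symm_apply_apply] at h1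
    have h2 : ((w k j : ℚ) : ℝ) = ((-∑ l, t (e l) * (w l j : ℚ) : ℚ) : ℝ) := by rw [h1]
    push_cast at h2
    linarith
  · left
    push Not at hcase
    obtain ⟨x, hx, hxk⟩ := hcase
    let D : ℕ := ∏ i, (x i).den
    have hD : 0 < D := Finset.prod_pos fun i _ => (x i).den_pos
    have hz : ∀ i, ∃ z : ℤ, (z : ℚ) = D * x i := by
      intro i
      obtain ⟨c, hc⟩ := Finset.dvd_prod_of_mem (fun i => (x i).den) (Finset.mem_univ i)
      refine ⟨c * (x i).num, ?_⟩
      have : (D : ℚ) = (x i).den * c := by exact_mod_cast hc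
      rw [this]
      push_cast
      rw [mul_comm ((x i).den : ℚ), mul_assoc, mul_comm ((x i).den : ℚ), Rat.mul_den_eq_num]
    choose u hu using hz
    have hdot : ∀ v : Fin N → ℤ, ((u ⬝ᵥ v : ℤ) : ℚ) = D * ev v x := by
      intro v
      rw [hev]
      simp only [dotProduct]
      push_cast
      rw [Finset.mul_sum]
      exact Finset.sum_congr rfl fun i _ => by rw [hu]; ring
    have hD' : (0 : ℚ) < D := by exact_mod_cast hD
    refine ⟨u, fun l => ?_, ?_⟩
    · have h1 := hx (e l)
      simp only [Equiv.symm_apply_apply, LinearMap.neg_apply, Left.neg_nonpos_iff] at h1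
      have : (0 : ℚ) ≤ ((u ⬝ᵥ w l : ℤ) : ℚ) := by rw [hdot]; positivity
      exact_mod_cast this
    · have : (0 : ℚ) < ((u ⬝ᵥ w k : ℤ) : ℚ) := by rw [hdot]; positivity
      exact_mod_cast this

/-! # Unimodular cones -/

section Pairing

variable {N : ℕ}

/-- The value of an integral linear form at a real vector. -/
def latticePair (m : Fin N → ℤ) (y : Fin N → ℝ) : ℝ := ∑ i, (m i : ℝ) * y i

/-- An integral vector as a real vector. -/
def realVec (b : Fin N → ℤ) : Fin N → ℝ := fun i => (b i : ℝ)

theorem latticePair_realVec (m b : Fin N → ℤ) : latticePair m (realVec b) = ((m ⬝ᵥ b : ℤ) : ℝ) := by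
  simp [latticePair, realVec, dotProduct]

theorem latticePair_add_right (m : Fin N → ℤ) (y y' : Fin N → ℝ) :
    latticePair m (y + y') = latticePair m y + latticePair m y' := by
  simp [latticePair, mul_add, Finset.sum_add_distrib]

theorem latticePair_smul_right (m : Fin N → ℤ) (t : ℝ) (y : Fin N → ℝ) :
    latticePair m (t • y) = t * latticePair m y := by
  simp only [latticePair, Finset.mul_sum, Pi.smul_apply, smul_eq_mul]
  exact Finset.sum_congr rfl fun i _ => by ring

theorem latticePair_sum_right {ι : Type*} (s : Finset ι) (m : Fin N → ℤ) (y : ι → Fin N → ℝ) :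
    latticePair m (∑ k ∈ s, y k) = ∑ k ∈ s, latticePair m (y k) := by
  simp only [latticePair, Finset.sum_apply, Finset.mul_sum]
  exact Finset.sum_comm

theorem latticePair_neg_left (m : Fin N → ℤ) (y : Fin N → ℝ) :
    latticePair (-m) y = -latticePair m y := by
  simp [latticePair]

theorem latticePair_sum_smul_left {ι : Type*} (s : Finset ι) (c : ι → ℤ) (d : ι → Fin N → ℤ)
    (y : Fin N → ℝ) :
    latticePair (∑ k ∈ s, c k • d k) y = ∑ k ∈ s, (c k : ℝ) * latticePair (d k) y := by
  simp only [latticePair, Finset.sum_apply, Finset.mul_sum, Pi.smul_apply, smul_eq_mul,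
    Int.cast_sum, Int.cast_mul, Finset.sum_mul]
  rw [Finset.sum_comm]
  exact Finset.sum_congr rfl fun i _ => Finset.sum_congr rfl fun j _ => by ring

theorem latticePair_single (j : Fin N) (y : Fin N → ℝ) :
    latticePair (Pi.single j 1) y = y j := by
  simp [latticePair, Pi.single_apply]

end Pairing

/-- A lattice basis, its dual basis, and a part of the basis that generates the cone `τ`. -/
structure ConeBasis {N : ℕ} (τ : Set (Fin N → ℝ)) where
  gen : Fin N → Fin N → ℤ
  dual : Fin N → Fin N → ℤ
  supp : Set (Fin N)
  dual_dot_gen : ∀ i j, dual i ⬝ᵥ gen j = if i = j then 1 else 0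
  expand : ∀ m : Fin N → ℤ, m = ∑ i, (m ⬝ᵥ gen i) • dual i
  mem_iff : ∀ y, y ∈ τ ↔ (∀ i, 0 ≤ latticePair (dual i) y) ∧
    ∀ i, i ∉ supp → latticePair (dual i) y = 0

theorem IsUnimodularCone.nonempty_coneBasis {N : ℕ} {τ : Set (Fin N → ℝ)}
    (h : IsUnimodularCone τ) : Nonempty (ConeBasis τ) := by
  obtain ⟨b, s, hτ⟩ := h
  let d : Fin N → Fin N → ℤ := fun i j => b.repr (Pi.single j 1) i
  have hd : ∀ i x, d i ⬝ᵥ x = b.repr x i := by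
    intro i x
    have := LinearMap.pi_apply_eq_sum_univ (b.coord i) x
    rw [Module.Basis.coord_apply] at this
    rw [this]
    refine Finset.sum_congr rfl fun j _ => ?_
    simp only [d, Module.Basis.coord_apply, smul_eq_mul]
    rw [mul_comm]
    congr 4
    ext l
    simp [Pi.single_apply, eq_comm]
  have hdb : ∀ i j, d i ⬝ᵥ b j = if i = j then 1 else 0 := by
    intro i j
    rw [hd, Module.Basis.repr_self, Finsupp.single_apply]
    simp [eq_comm]
  have hex : ∀ m : Fin N → ℤ, m = ∑ i, (m ⬝ᵥ b i) • d i := by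
    intro m
    ext j
    have h1 := b.sum_repr (Pi.single j (1 : ℤ))
    have h2 : m ⬝ᵥ (Pi.single j (1 : ℤ)) = m j := by simp
    rw [← h2, ← h1, dotProduct_sum, Finset.sum_apply]
    refine Finset.sum_congr rfl fun i _ => ?_
    rw [dotProduct_smul]
    simp [d, mul_comm]
  refine ⟨⟨b, d, s, hdb, hex, fun y => ?_⟩⟩
  rw [hτ]
  constructor
  · rintro ⟨t, ht, hts, hy⟩
    have hy' : y = ∑ i, t i • realVec (b i) := by
      ext j
      simp [hy, realVec]
    have key : ∀ i, latticePair (d i) y = t i := by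
      intro i
      rw [hy', latticePair_sum_right]
      simp [latticePair_smul_right, latticePair_realVec, hdb]
    exact ⟨fun i => (key i).symm ▸ ht i, fun i hi => (key i).symm ▸ hts i hi⟩
  · rintro ⟨h1, h2⟩
    refine ⟨fun i => latticePair (d i) y, h1, h2, fun j => ?_⟩
    rw [← latticePair_single j y, hex (Pi.single j 1), latticePair_sum_smul_left]
    exact Finset.sum_congr rfl fun i _ => by rw [single_one_dotProduct, mul_comm]

namespace ConeBasis

variable {N : ℕ} {τ σ : Set (Fin N → ℝ)} (B : ConeBasis τ)

theorem latticePair_eq (m : Fin N → ℤ) (y : Fin N → ℝ) :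
    latticePair m y = ∑ i, ((m ⬝ᵥ B.gen i : ℤ) : ℝ) * latticePair (B.dual i) y := by
  conv_lhs => rw [B.expand m]
  rw [latticePair_sum_smul_left]

theorem eq_sum (y : Fin N → ℝ) : y = ∑ i, latticePair (B.dual i) y • realVec (B.gen i) := by
  ext j
  rw [← latticePair_single j y, B.latticePair_eq, Finset.sum_apply]
  refine Finset.sum_congr rfl fun i _ => ?_
  rw [single_one_dotProduct, mul_comm]
  rfl

theorem add_mem (B : ConeBasis τ) {y y' : Fin N → ℝ} (hy : y ∈ τ) (hy' : y' ∈ τ) : y + y' ∈ τ := by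
  rw [B.mem_iff] at *
  refine ⟨fun i => ?_, fun i hi => ?_⟩
  · rw [latticePair_add_right]
    exact add_nonneg (hy.1 i) (hy'.1 i)
  · rw [latticePair_add_right, hy.2 i hi, hy'.2 i hi, add_zero]

theorem zero_mem (B : ConeBasis τ) : (0 : Fin N → ℝ) ∈ τ := by
  rw [B.mem_iff]
  simp [latticePair]

theorem smul_mem (B : ConeBasis τ) {y : Fin N → ℝ} (hy : y ∈ τ) {t : ℝ} (ht : 0 ≤ t) : t • y ∈ τ := by
  rw [B.mem_iff] at *
  refine ⟨fun i => ?_, fun i hi => ?_⟩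
  · rw [latticePair_smul_right]
    exact mul_nonneg ht (hy.1 i)
  · rw [latticePair_smul_right, hy.2 i hi, mul_zero]

theorem sum_smul_mem (B : ConeBasis τ) {ι : Type*} (s : Finset ι) {t : ι → ℝ} {v : ι → Fin N → ℝ}
    (ht : ∀ k, 0 ≤ t k) (hv : ∀ k, t k ≠ 0 → v k ∈ τ) : ∑ k ∈ s, t k • v k ∈ τ := by
  classical
  induction s using Finset.induction_on with
  | empty => simpa using B.zero_mem
  | insert k s hk ih =>
    rw [Finset.sum_insert hk]
    refine B.add_mem ?_ ih
    by_cases h : t k = 0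
    · simpa [h] using B.zero_mem
    · exact B.smul_mem (hv k h) (ht k)

theorem gen_mem {i : Fin N} (hi : i ∈ B.supp) : realVec (B.gen i) ∈ τ := by
  rw [B.mem_iff]
  refine ⟨fun j => ?_, fun j hj => ?_⟩
  · rw [latticePair_realVec, B.dual_dot_gen]
    split_ifs <;> simp
  · rw [latticePair_realVec, B.dual_dot_gen, if_neg (by rintro rfl; exact hj hi), Int.cast_zero]

theorem mem_dualSemigroup_iff (m : Fin N → ℤ) :
    m ∈ dualSemigroup τ ↔ ∀ i ∈ B.supp, 0 ≤ m ⬝ᵥ B.gen i := by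
  constructor
  · intro h i hi
    have : 0 ≤ latticePair m (realVec (B.gen i)) := h _ (B.gen_mem hi)
    rw [latticePair_realVec] at this
    exact_mod_cast this
  · intro h y hy
    change 0 ≤ latticePair m y
    rw [B.latticePair_eq]
    refine Finset.sum_nonneg fun i _ => ?_
    by_cases hi : i ∈ B.supp
    · exact mul_nonneg (by exact_mod_cast h i hi) (((B.mem_iff y).1 hy).1 i)
    · rw [((B.mem_iff y).1 hy).2 i hi, mul_zero]

theorem dual_mem (i : Fin N) : B.dual i ∈ dualSemigroup τ := by
  rw [B.mem_dualSemigroup_iff]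
  intro j _
  rw [B.dual_dot_gen]
  split_ifs <;> simp

theorem neg_dual_mem {i : Fin N} (hi : i ∉ B.supp) : -B.dual i ∈ dualSemigroup τ := by
  rw [B.mem_dualSemigroup_iff]
  intro j hj
  rw [neg_dotProduct, B.dual_dot_gen, if_neg (by rintro rfl; exact hi hj), neg_zero]

/-- The bidual of a unimodular cone is the cone. -/
theorem mem_of_forall_dual (B : ConeBasis τ) {y : Fin N → ℝ} (h : ∀ m ∈ dualSemigroup τ, 0 ≤ latticePair m y) :
    y ∈ τ := by
  rw [B.mem_iff]
  refine ⟨fun i => h _ (B.dual_mem i), fun i hi => le_antisymm ?_ (h _ (B.dual_mem i))⟩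
  have := h _ (B.neg_dual_mem hi)
  rw [latticePair_neg_left] at this
  linarith

/-- An integral linear form that separates two cones meeting in a common extreme subset. -/
theorem exists_separating (B : ConeBasis τ) (B' : ConeBasis σ)
    (h : ∀ y y', y ∈ τ → y' ∈ τ → y + y' ∈ σ → y ∈ σ)
    (h' : ∀ y y', y ∈ σ → y' ∈ σ → y + y' ∈ τ → y ∈ τ) :
    ∃ u : Fin N → ℤ, u ∈ dualSemigroup τ ∧ -u ∈ dualSemigroup σ ∧
      (∀ y ∈ τ, latticePair u y = 0 → y ∈ σ) ∧ ∀ y ∈ σ, latticePair u y = 0 → y ∈ τ := by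
  classical
  -- With the generators of `σ` negated, nonnegativity on `w` means nonnegative on `τ` and
  -- nonpositive on `σ`.
  let w : B.supp ⊕ B'.supp → Fin N → ℤ := Sum.elim (fun i => B.gen i) (fun j => -B'.gen j)
  have hsep : ∀ k, ∃ u : Fin N → ℤ, (∀ l, 0 ≤ u ⬝ᵥ w l) ∧ (0 < u ⬝ᵥ w k ∨
      ∃ t : B.supp ⊕ B'.supp → ℝ, (∀ l, 0 ≤ t l) ∧
        ∀ j, -(w k j : ℝ) = ∑ l, t l * (w l j : ℝ)) := by
    intro k
    rcases exists_int_form_or_neg_mem_cone w k with ⟨u, hu, hk⟩ | ht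
    · exact ⟨u, hu, Or.inl hk⟩
    · exact ⟨0, by simp, Or.inr ht⟩
  choose U hU hU' using hsep
  -- The sum is positive on every `w k` on which some admissible form is positive, so it vanishes
  -- only where `-w k` lies in the cone of the family.
  let u := ∑ k, U k
  have hu : ∀ l, 0 ≤ u ⬝ᵥ w l := fun l => by
    rw [sum_dotProduct]
    exact Finset.sum_nonneg fun k _ => hU k l
  have hu0 : ∀ k, u ⬝ᵥ w k = 0 → ∃ t : B.supp ⊕ B'.supp → ℝ, (∀ l, 0 ≤ t l) ∧
        ∀ j, -(w k j : ℝ) = ∑ l, t l * (w l j : ℝ) := by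
    intro k hk
    refine (hU' k).resolve_left fun hpos => ?_
    rw [sum_dotProduct] at hk
    exact hpos.ne' ((Finset.sum_eq_zero_iff_of_nonneg fun k' _ => hU k' k).1 hk k
      (Finset.mem_univ k))
  -- Moving the `σ`-terms of the relation to one side shows that `gen i` plus an element of `τ` lies
  -- in `σ`; extremality then puts `gen i` in `σ`.
  have e1 : ∀ i : B.supp, u ⬝ᵥ B.gen i = 0 → realVec (B.gen i) ∈ σ := by
    intro i hi
    obtain ⟨t, ht, hti⟩ := hu0 (Sum.inl i) hi
    refine h _ (∑ l, t (Sum.inl l) • realVec (B.gen l)) (B.gen_mem i.2)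
      (B.sum_smul_mem _ (fun l => ht _) fun l _ => B.gen_mem l.2) ?_
    have : realVec (B.gen i) + ∑ l, t (Sum.inl l) • realVec (B.gen l)
        = ∑ l : B'.supp, t (Sum.inr l) • realVec (B'.gen l) := by
      ext j
      have := hti j
      simp only [w, Fintype.sum_sum_type, Sum.elim_inl, Sum.elim_inr, Pi.neg_apply, Int.cast_neg,
        mul_neg, Finset.sum_neg_distrib] at this
      simp only [realVec, Pi.add_apply, Finset.sum_apply, Pi.smul_apply, smul_eq_mul]
      linarith
    rw [this]
    exact B'.sum_smul_mem _ (fun l => ht _) fun l _ => B'.gen_mem l.2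
  have e2 : ∀ i : B'.supp, u ⬝ᵥ B'.gen i = 0 → realVec (B'.gen i) ∈ τ := by
    intro i hi
    obtain ⟨t, ht, hti⟩ := hu0 (Sum.inr i) (by simp [w, hi])
    refine h' _ (∑ l, t (Sum.inr l) • realVec (B'.gen l)) (B'.gen_mem i.2)
      (B'.sum_smul_mem _ (fun l => ht _) fun l _ => B'.gen_mem l.2) ?_
    have : realVec (B'.gen i) + ∑ l, t (Sum.inr l) • realVec (B'.gen l)
        = ∑ l : B.supp, t (Sum.inl l) • realVec (B.gen l) := by
      ext j
      have := hti j
      simp only [w, Fintype.sum_sum_type, Sum.elim_inl, Sum.elim_inr, Pi.neg_apply, Int.cast_neg,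
        mul_neg, Finset.sum_neg_distrib, neg_neg] at this
      simp only [realVec, Pi.add_apply, Finset.sum_apply, Pi.smul_apply, smul_eq_mul]
      linarith
    rw [this]
    exact B.sum_smul_mem _ (fun l => ht _) fun l _ => B.gen_mem l.2
  have huτ : u ∈ dualSemigroup τ :=
    (B.mem_dualSemigroup_iff u).2 fun i hi => hu (Sum.inl ⟨i, hi⟩)
  have huσ : -u ∈ dualSemigroup σ := (B'.mem_dualSemigroup_iff _).2 fun i hi => by
    have := hu (Sum.inr ⟨i, hi⟩)
    simp only [w, Sum.elim_inr, dotProduct_neg] at this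
    rwa [neg_dotProduct]
  refine ⟨u, huτ, huσ, fun y hy hy0 => ?_, fun y hy hy0 => ?_⟩
  · have hy' := (B.mem_iff y).1 hy
    rw [B.latticePair_eq, Finset.sum_eq_zero_iff_of_nonneg] at hy0
    · rw [B.eq_sum y]
      refine B'.sum_smul_mem _ hy'.1 fun k hk => ?_
      have hks : k ∈ B.supp := by
        by_contra hks
        exact hk (hy'.2 k hks)
      have := (mul_eq_zero.1 (hy0 k (Finset.mem_univ k))).resolve_right hk
      exact e1 ⟨k, hks⟩ (by exact_mod_cast this)
    · intro k _
      by_cases hks : k ∈ B.supp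
      · exact mul_nonneg (by exact_mod_cast (B.mem_dualSemigroup_iff u).1 huτ k hks) (hy'.1 k)
      · rw [hy'.2 k hks, mul_zero]
  · have hy' := (B'.mem_iff y).1 hy
    rw [B'.latticePair_eq, Finset.sum_eq_zero_iff_of_nonpos] at hy0
    · rw [B'.eq_sum y]
      refine B.sum_smul_mem _ hy'.1 fun k hk => ?_
      have hks : k ∈ B'.supp := by
        by_contra hks
        exact hk (hy'.2 k hks)
      have := (mul_eq_zero.1 (hy0 k (Finset.mem_univ k))).resolve_right hk
      exact e2 ⟨k, hks⟩ (by exact_mod_cast this)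
    · intro k _
      by_cases hks : k ∈ B'.supp
      · have h3 := (B'.mem_dualSemigroup_iff _).1 huσ k hks
        rw [neg_dotProduct] at h3
        exact mul_nonpos_of_nonpos_of_nonneg (by exact_mod_cast (by linarith)) (hy'.1 k)
      · rw [hy'.2 k hks, mul_zero]

end ConeBasis

/-! # The fan of a unimodular polyhedral subdivision -/

namespace PolyhedralSubdivision

variable {n : ℕ} (S : PolyhedralSubdivision n)

theorem init_add (y y' : Fin (n + 1) → ℝ) :
    (Fin.init (y + y') : Fin n → ℝ) = Fin.init y + Fin.init y' := rfl

theorem init_smul (t : ℝ) (y : Fin (n + 1) → ℝ) :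
    (Fin.init (t • y) : Fin n → ℝ) = t • Fin.init y := rfl

theorem mem_coneOver_iff_of_last_eq_zero {P : Set (Fin n → ℝ)} {y : Fin (n + 1) → ℝ}
    (hy : y (Fin.last n) = 0) : y ∈ coneOver P ↔ Fin.init y ∈ recessionCone P := by
  simp [coneOver, levelZeroCone, hy]

theorem mem_coneOver_iff_of_last_pos {P : Set (Fin n → ℝ)} {y : Fin (n + 1) → ℝ}
    (hy : 0 < y (Fin.last n)) :
    y ∈ coneOver P ↔ (y (Fin.last n))⁻¹ • (Fin.init y : Fin n → ℝ) ∈ P := by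
  simp [coneOver, levelZeroCone, hy, hy.ne']

variable {S}

/-- The two kinds of cone agree on level `0`, so arguments there involve recession cones only, while
off level `0` only `coneOver` remains. -/
theorem exists_cell_of_mem_fan {τ : Set (Fin (n + 1) → ℝ)} (hτ : τ ∈ S.fan) :
    ∃ P ∈ S.cells, (∀ y : Fin (n + 1) → ℝ, y (Fin.last n) = 0 →
        (y ∈ τ ↔ Fin.init y ∈ recessionCone P)) ∧
      ((∃ y ∈ τ, y (Fin.last n) ≠ 0) → τ = coneOver P) := by
  obtain ⟨P, hP, rfl | rfl⟩ := hτ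
  · exact ⟨P, hP, fun y hy => mem_coneOver_iff_of_last_eq_zero hy, fun _ => rfl⟩
  · exact ⟨P, hP, fun y hy => by simp [levelZeroCone, hy], fun ⟨y, hy, hy0⟩ => absurd hy.1 hy0⟩

/-- The intersection of two cones of the fan is extreme in either of them. -/
theorem IsUnimodular.mem_of_add_mem (hS : S.IsUnimodular) {τ σ : Set (Fin (n + 1) → ℝ)}
    (hτ : τ ∈ S.fan) (hσ : σ ∈ S.fan) {y y' : Fin (n + 1) → ℝ} (hy : y ∈ τ) (hy' : y' ∈ τ)
    (h : y + y' ∈ σ) : y ∈ σ := by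
  obtain ⟨P, hP, hτ0, hτ1⟩ := exists_cell_of_mem_fan hτ
  obtain ⟨Q, hQ, hσ0, hσ1⟩ := exists_cell_of_mem_fan hσ
  obtain ⟨B⟩ := (hS τ hτ).nonempty_coneBasis
  have hadd := B.add_mem hy hy'
  have hl := S.last_nonneg hτ hy
  have hl' := S.last_nonneg hτ hy'
  by_cases h0 : (y + y') (Fin.last n) = 0
  · rw [hσ0 _ h0, init_add] at h
    rw [Pi.add_apply] at h0
    have hy0 : y (Fin.last n) = 0 := by linarith
    have hy0' : y' (Fin.last n) = 0 := by linarith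
    rw [hτ0 _ hy0] at hy
    rw [hτ0 _ hy0'] at hy'
    rw [hσ0 _ hy0]
    exact mem_recessionCone_of_add_mem hP hQ hy hy' h
  · have hτ2 : τ = coneOver P := hτ1 ⟨_, hadd, h0⟩
    have hσ2 : σ = coneOver Q := hσ1 ⟨_, h, h0⟩
    subst hτ2 hσ2
    have hpos : 0 < (y + y') (Fin.last n) := by
      rw [Pi.add_apply] at h0 ⊢
      exact lt_of_le_of_ne (by linarith) (Ne.symm h0)
    rw [mem_coneOver_iff_of_last_pos hpos] at h hadd
    set z := ((y + y') (Fin.last n))⁻¹ • (Fin.init (y + y') : Fin n → ℝ) with hz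
    obtain ⟨l, hl⟩ := S.inter_face P hP Q hQ ⟨z, hadd, h⟩ ⟨z, hadd, h⟩
    have hzmem : z ∈ P ∩ Q := ⟨hadd, h⟩
    have hmax : ∀ x ∈ P, l x ≤ l z := by rw [hl] at hzmem; exact hzmem.2
    have hface : ∀ x ∈ P, l z ≤ l x → x ∈ Q := fun x hx hx' => by
      have : x ∈ P ∩ Q := by
        rw [hl]
        exact ⟨hx, fun x' hx1 => (hmax x' hx1).trans hx'⟩
      exact this.2
    have hrec : ∀ v ∈ recessionCone P, l v ≤ 0 := fun v hv => by
      have := hmax _ (hv z hadd)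
      rw [map_add] at this
      linarith
    -- Homogenised, the form exposing `P ∩ Q` gives an inequality on the whole cone over `P`.
    -- Equality at `y + y'` forces equality at `y`.
    have hnonneg : ∀ x ∈ coneOver P, l (Fin.init x) ≤ x (Fin.last n) * l z := by
      intro x hx
      rcases (S.last_nonneg ⟨P, hP, Or.inl rfl⟩ hx).eq_or_lt with hx0 | hx0
      · rw [mem_coneOver_iff_of_last_eq_zero hx0.symm] at hx
        rw [← hx0, zero_mul]
        exact hrec _ hx
      · rw [mem_coneOver_iff_of_last_pos hx0] at hx
        have := hmax _ hx
        rw [map_smul, smul_eq_mul] at this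
        rwa [inv_mul_le_iff₀ hx0] at this
    have h1 := hnonneg y hy
    have h2 := hnonneg y' hy'
    have h3 : l (Fin.init (y + y')) = (y + y') (Fin.last n) * l z := by
      rw [hz, map_smul, smul_eq_mul, mul_inv_cancel_left₀ hpos.ne']
    rw [init_add, map_add, Pi.add_apply, add_mul] at h3
    have h4 : l (Fin.init y) = y (Fin.last n) * l z := by linarith
    rcases (S.last_nonneg hτ hy).eq_or_lt with hy0 | hy0
    · rw [mem_coneOver_iff_of_last_eq_zero hy0.symm] at hy ⊢
      rw [← hy0, zero_mul] at h4
      refine (S.isPolyhedron Q hQ).mem_recessionCone_of_frequently (x := z) ?_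
      refine ((Filter.eventually_ge_atTop 0).mono fun t ht => ?_).frequently
      refine hface _ ((S.isPolyhedron P hP).smul_mem_recessionCone ⟨z, hadd⟩ hy ht z hadd) ?_
      rw [map_add, map_smul l t, h4, smul_zero, add_zero]
    · rw [mem_coneOver_iff_of_last_pos hy0] at hy ⊢
      refine hface _ hy ?_
      rw [map_smul l (y (Fin.last n))⁻¹, h4, smul_eq_mul, inv_mul_cancel_left₀ hy0.ne']

variable (S) in
/-- The fan covers the upper half-space. -/
theorem exists_mem_fan {y : Fin (n + 1) → ℝ} (hy : 0 ≤ y (Fin.last n)) : ∃ τ ∈ S.fan, y ∈ τ := by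
  rcases hy.eq_or_lt with h | h
  · obtain ⟨C, hC, hv, -⟩ := S.exists_cell_ray 0 (Fin.init y)
    exact ⟨_, ⟨C, hC, Or.inl rfl⟩, (mem_coneOver_iff_of_last_eq_zero h.symm).2 hv⟩
  · have : (y (Fin.last n))⁻¹ • (Fin.init y : Fin n → ℝ) ∈ ⋃₀ S.cells := by
      rw [S.complete]; trivial
    obtain ⟨C, hC, hv⟩ := this
    exact ⟨_, ⟨C, hC, Or.inl rfl⟩, (mem_coneOver_iff_of_last_pos h).2 hv⟩

theorem IsUnimodular.exists_separating (hS : S.IsUnimodular) {τ σ : Set (Fin (n + 1) → ℝ)}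
    (hτ : τ ∈ S.fan) (hσ : σ ∈ S.fan) :
    ∃ u : Fin (n + 1) → ℤ, u ∈ dualSemigroup τ ∧ -u ∈ dualSemigroup σ ∧
      (∀ y ∈ τ, latticePair u y = 0 → y ∈ σ) ∧ ∀ y ∈ σ, latticePair u y = 0 → y ∈ τ := by
  obtain ⟨B⟩ := (hS τ hτ).nonempty_coneBasis
  obtain ⟨B'⟩ := (hS σ hσ).nonempty_coneBasis
  exact ConeBasis.exists_separating B B' (fun y y' => hS.mem_of_add_mem hτ hσ)
    (fun y y' => hS.mem_of_add_mem hσ hτ)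

theorem snoc_mem_coneOver_iff {P : Set (Fin n → ℝ)} {x : Fin n → ℝ} :
    (Fin.snoc x (1 : ℝ) : Fin (n + 1) → ℝ) ∈ coneOver P ↔ x ∈ P := by
  rw [mem_coneOver_iff_of_last_pos (by simp)]
  simp

/-- A linear form that is nonpositive on the recession cone of a cell has a maximum on it. -/
theorem IsUnimodular.exists_max (hS : S.IsUnimodular) {P : Set (Fin n → ℝ)} (hP : P ∈ S.cells)
    (f : (Fin n → ℝ) →ₗ[ℝ] ℝ) (hf : ∀ v ∈ recessionCone P, f v ≤ 0) :
    ∃ x ∈ P, ∀ y ∈ P, f y ≤ f x := by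
  have hτ : coneOver P ∈ S.fan := ⟨P, hP, Or.inl rfl⟩
  obtain ⟨B⟩ := (hS _ hτ).nonempty_coneBasis
  let g : Fin (n + 1) → Fin (n + 1) → ℝ := fun i => realVec (B.gen i)
  -- Generators above level `0`, rescaled to height `1`, are points of `P`, and `P` is their convex
  -- hull plus its recession cone. The maximum is therefore attained at one of them.
  let V : Set (Fin (n + 1)) := {i | i ∈ B.supp ∧ 0 < g i (Fin.last n)}
  have hdec : ∀ y ∈ P, ∃ t : Fin (n + 1) → ℝ, (∀ i, 0 ≤ t i) ∧ (∀ i, i ∉ B.supp → t i = 0) ∧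
      f y = ∑ i, t i * f (Fin.init (g i)) ∧ 1 = ∑ i, t i * g i (Fin.last n) := by
    intro y hy
    have hy' := (B.mem_iff _).1 (snoc_mem_coneOver_iff.2 hy)
    refine ⟨_, hy'.1, hy'.2, ?_, ?_⟩
    · have h1 := B.eq_sum (Fin.snoc y (1 : ℝ))
      have h2 : y = ∑ i, latticePair (B.dual i) (Fin.snoc y (1 : ℝ)) • Fin.init (g i) := by
        ext j
        have := congrFun h1 j.castSucc
        rw [Fin.snoc_castSucc, Finset.sum_apply] at this
        rw [Finset.sum_apply]
        exact this
      conv_lhs => rw [h2]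
      simp
    · have h1 := congrFun (B.eq_sum (Fin.snoc y (1 : ℝ))) (Fin.last n)
      rw [Fin.snoc_last, Finset.sum_apply] at h1
      exact h1
  have hV : V.Nonempty := by
    obtain ⟨y, hy⟩ := S.nonempty P hP
    obtain ⟨t, ht0, hts, -, ht1⟩ := hdec y hy
    by_contra hV
    rw [Set.not_nonempty_iff_eq_empty] at hV
    have : ∑ i, t i * g i (Fin.last n) ≤ 0 := by
      refine Finset.sum_nonpos fun i _ => ?_
      by_cases hi : i ∈ B.supp
      · refine mul_nonpos_of_nonneg_of_nonpos (ht0 i) ?_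
        by_contra! hpos
        have : i ∈ V := ⟨hi, hpos⟩
        rw [hV] at this
        exact this
      · rw [hts i hi, zero_mul]
    linarith
  obtain ⟨k, hk, hmax⟩ := Set.exists_max_image V
    (fun i => (g i (Fin.last n))⁻¹ * f (Fin.init (g i))) V.toFinite hV
  refine ⟨(g k (Fin.last n))⁻¹ • Fin.init (g k),
    (mem_coneOver_iff_of_last_pos hk.2).1 (B.gen_mem hk.1), fun y hy => ?_⟩
  obtain ⟨t, ht0, hts, hfy, ht1⟩ := hdec y hy
  rw [map_smul, smul_eq_mul]
  set M := (g k (Fin.last n))⁻¹ * f (Fin.init (g k))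
  rw [hfy, ← one_mul M, ht1, Finset.sum_mul]
  refine Finset.sum_le_sum fun i _ => ?_
  by_cases hi : i ∈ B.supp
  · rw [mul_assoc]
    refine mul_le_mul_of_nonneg_left ?_ (ht0 i)
    rcases (S.last_nonneg hτ (B.gen_mem hi)).eq_or_lt with h0 | h0
    · have h1 : g i (Fin.last n) = 0 := h0.symm
      rw [h1, zero_mul]
      exact hf _ ((mem_coneOver_iff_of_last_eq_zero h1).1 (B.gen_mem hi))
    · have := hmax i ⟨hi, h0⟩
      rwa [inv_mul_le_iff₀ h0] at this
  · rw [hts i hi, zero_mul, zero_mul, zero_mul]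

/-- Cones meeting above level `0` meet in the cone over `P ∩ Q`. Otherwise the intersection of the
recession cones must be realised by a cell: the face of `P` on which the negative of a separating
form is maximal has exactly this recession cone, and `exists_max` makes that face nonempty. -/
theorem IsUnimodular.inter_mem_fan (hS : S.IsUnimodular) {τ σ : Set (Fin (n + 1) → ℝ)}
    (hτ : τ ∈ S.fan) (hσ : σ ∈ S.fan) : τ ∩ σ ∈ S.fan := by
  have hn : ∀ y ∈ τ, 0 ≤ y (Fin.last n) := fun y hy => S.last_nonneg hτ hy
  obtain ⟨P, hP, hτ0, hτ1⟩ := exists_cell_of_mem_fan hτ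
  obtain ⟨Q, hQ, hσ0, hσ1⟩ := exists_cell_of_mem_fan hσ
  by_cases hpos : ∃ y ∈ τ ∩ σ, y (Fin.last n) ≠ 0
  · obtain ⟨y, hy, hy0⟩ := hpos
    have hτ2 : τ = coneOver P := hτ1 ⟨_, hy.1, hy0⟩
    have hσ2 : σ = coneOver Q := hσ1 ⟨_, hy.2, hy0⟩
    subst hτ2 hσ2
    have hyp : 0 < y (Fin.last n) := lt_of_le_of_ne (hn y hy.1) (Ne.symm hy0)
    have hne : (P ∩ Q).Nonempty := ⟨_, (mem_coneOver_iff_of_last_pos hyp).1 hy.1,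
      (mem_coneOver_iff_of_last_pos hyp).1 hy.2⟩
    have hPQ : P ∩ Q ∈ S.cells := S.face_mem P hP _ hne (S.inter_face P hP Q hQ hne)
    refine ⟨P ∩ Q, hPQ, Or.inl ?_⟩
    have hrec : ∀ v, v ∈ recessionCone (P ∩ Q) ↔ v ∈ recessionCone P ∧ v ∈ recessionCone Q := by
      intro v
      refine ⟨fun hv => ?_, fun hv x hx => ⟨hv.1 x hx.1, hv.2 x hx.2⟩⟩
      obtain ⟨z, hz⟩ := hne
      have hray := (S.isPolyhedron _ hPQ).eventually_mem_of_mem_recessionCone (t₀ := 0)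
        (x := z) (by simpa using hz) hv
      exact ⟨(S.isPolyhedron P hP).mem_recessionCone_of_frequently (x := z)
          ((Filter.eventually_ge_atTop 0).mono fun t ht => (hray t ht).1).frequently,
        (S.isPolyhedron Q hQ).mem_recessionCone_of_frequently (x := z)
          ((Filter.eventually_ge_atTop 0).mono fun t ht => (hray t ht).2).frequently⟩
    ext x
    have hx' : (x ∈ coneOver P → 0 ≤ x (Fin.last n)) ∧
      (x ∈ coneOver (P ∩ Q) → 0 ≤ x (Fin.last n)) :=
      ⟨hn x, fun h => S.last_nonneg ⟨_, hPQ, Or.inl rfl⟩ h⟩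
    rcases lt_trichotomy (x (Fin.last n)) 0 with hx | hx | hx
    · refine ⟨fun h => absurd (hx'.1 h.1) hx.not_ge, fun h => absurd (hx'.2 h) hx.not_ge⟩
    · rw [Set.mem_inter_iff, mem_coneOver_iff_of_last_eq_zero hx,
        mem_coneOver_iff_of_last_eq_zero hx, mem_coneOver_iff_of_last_eq_zero hx, hrec]
    · rw [Set.mem_inter_iff, mem_coneOver_iff_of_last_pos hx,
        mem_coneOver_iff_of_last_pos hx, mem_coneOver_iff_of_last_pos hx]
      rfl
  · push Not at hpos
    have hzP : levelZeroCone P ∈ S.fan := ⟨P, hP, Or.inr rfl⟩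
    have hzQ : levelZeroCone Q ∈ S.fan := ⟨Q, hQ, Or.inr rfl⟩
    obtain ⟨u, huP, huQ, hu1, -⟩ := hS.exists_separating hzP hzQ
    let f : (Fin n → ℝ) →ₗ[ℝ] ℝ := -Fintype.linearCombination ℝ (fun j => (u j.castSucc : ℝ))
    have hfu : ∀ v : Fin n → ℝ, f v = -latticePair u (Fin.snoc v (0 : ℝ)) := by
      intro v
      simp [f, Fintype.linearCombination_apply, latticePair, Fin.sum_univ_castSucc, mul_comm]
    have hlz : ∀ (R : Set (Fin n → ℝ)) v, v ∈ recessionCone R ↔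
        (Fin.snoc v (0 : ℝ) : Fin (n + 1) → ℝ) ∈ levelZeroCone R := by
      intro R v
      simp [levelZeroCone]
    have hfP : ∀ v ∈ recessionCone P, f v ≤ 0 := by
      intro v hv
      rw [hfu, neg_nonpos]
      exact huP _ ((hlz P v).1 hv)
    have hfPQ : ∀ v ∈ recessionCone P, (f v = 0 ↔ v ∈ recessionCone Q) := by
      intro v hv
      rw [hfu, neg_eq_zero]
      refine ⟨fun h => (hlz Q v).2 (hu1 _ ((hlz P v).1 hv) h), fun h => le_antisymm ?_
        (huP _ ((hlz P v).1 hv))⟩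
      have : 0 ≤ latticePair (-u) (Fin.snoc v (0 : ℝ)) := huQ _ ((hlz Q v).1 h)
      rw [latticePair_neg_left] at this
      linarith
    obtain ⟨x, hx, hmax⟩ := hS.exists_max hP f hfP
    let F : Set (Fin n → ℝ) := {z ∈ P | ∀ y ∈ P, f y ≤ f z}
    have hxF : x ∈ F := ⟨hx, hmax⟩
    have hF : F ∈ S.cells := S.face_mem P hP F ⟨x, hxF⟩ fun _ =>
      ⟨LinearMap.toContinuousLinearMap f, rfl⟩
    refine ⟨F, hF, Or.inr ?_⟩
    have hrec : ∀ v, v ∈ recessionCone F ↔ v ∈ recessionCone P ∧ v ∈ recessionCone Q := by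
      intro v
      constructor
      · intro hv
        have hvP : v ∈ recessionCone P :=
          (S.isPolyhedron P hP).mem_recessionCone_of_frequently (x := x)
            ((Filter.eventually_ge_atTop 0).mono fun t ht =>
              ((S.isPolyhedron F hF).smul_mem_recessionCone ⟨x, hxF⟩ hv ht x hxF).1).frequently
        refine ⟨hvP, (hfPQ v hvP).1 (le_antisymm (hfP v hvP) ?_)⟩
        have := (hv x hxF).2 x hx
        rw [map_add] at this
        linarith
      · rintro ⟨hv1, hv2⟩ z hz
        refine ⟨hv1 z hz.1, fun y hy => ?_⟩
        rw [map_add, (hfPQ v hv1).2 hv2, add_zero]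
        exact hz.2 y hy
    ext y
    constructor
    · intro hy
      have h0 := hpos y hy
      exact ⟨h0, (hrec _).2 ⟨(hτ0 y h0).1 hy.1, (hσ0 y h0).1 hy.2⟩⟩
    · rintro ⟨h0, hy⟩
      exact ⟨(hτ0 y h0).2 ((hrec _).1 hy).1, (hσ0 y h0).2 ((hrec _).1 hy).2⟩

/-- The generators of the cones of `C(Σ)` lie on level `0` or `1`. -/
theorem IsStronglyUnimodular.gen_last (hS : S.IsStronglyUnimodular)
    {τ : Set (Fin (n + 1) → ℝ)} (hτ : τ ∈ S.fan) (B : ConeBasis τ) {i : Fin (n + 1)}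
    (hi : i ∈ B.supp) : B.gen i (Fin.last n) = 0 ∨ B.gen i (Fin.last n) = 1 := by
  by_cases h0 : B.gen i (Fin.last n) = 0
  · exact Or.inl h0
  have hgi : realVec (B.gen i) (Fin.last n) ≠ 0 := by
    simpa [realVec] using h0
  obtain ⟨P, hP, -, hτ1⟩ := exists_cell_of_mem_fan hτ
  have hτ2 : τ = coneOver P := hτ1 ⟨_, B.gen_mem hi, hgi⟩
  subst hτ2
  have hgpos : 0 < realVec (B.gen i) (Fin.last n) :=
    lt_of_le_of_ne (S.last_nonneg hτ (B.gen_mem hi)) (Ne.symm hgi)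
  set h := realVec (B.gen i) (Fin.last n)
  let x₀ : Fin n → ℝ := h⁻¹ • Fin.init (realVec (B.gen i))
  have hx₀ : x₀ ∈ P := (mem_coneOver_iff_of_last_pos hgpos).1 (B.gen_mem hi)
  -- On the cone this form vanishes only along the ray of `gen i`. Its negative therefore exposes
  -- the vertex `x₀` of `P`, which makes that ray a cone of the fan, so that the hypothesis on
  -- primitive generators applies.
  let m : Fin (n + 1) → ℤ := ∑ j ∈ Finset.univ.erase i, B.dual j
  have hm : ∀ y, latticePair m y = ∑ j ∈ Finset.univ.erase i, latticePair (B.dual j) y := by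
    intro y
    have := latticePair_sum_smul_left (Finset.univ.erase i) (fun _ => 1) B.dual y
    simpa only [one_smul, Int.cast_one, one_mul] using this
  let f : (Fin n → ℝ) →ₗ[ℝ] ℝ := -Fintype.linearCombination ℝ (fun j => (m j.castSucc : ℝ))
  have hfm : ∀ x : Fin n → ℝ, f x = m (Fin.last n) - latticePair m (Fin.snoc x (1 : ℝ)) := by
    intro v
    simp [f, Fintype.linearCombination_apply, latticePair, Fin.sum_univ_castSucc, mul_comm]
  have hsn : (Fin.snoc x₀ (1 : ℝ) : Fin (n + 1) → ℝ) = h⁻¹ • realVec (B.gen i) := by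
    ext j
    refine Fin.lastCases ?_ (fun j => ?_) j
    · simp [h, inv_mul_cancel₀ hgi]
    · rw [Fin.snoc_castSucc]
      rfl
  have hm0 : latticePair m (Fin.snoc x₀ (1 : ℝ)) = 0 := by
    rw [hm, hsn]
    refine Finset.sum_eq_zero fun j hj => ?_
    rw [latticePair_smul_right, latticePair_realVec, B.dual_dot_gen,
      if_neg (Finset.ne_of_mem_erase hj), Int.cast_zero, mul_zero]
  have hnn : ∀ x ∈ P, ∀ j, 0 ≤ latticePair (B.dual j) (Fin.snoc x (1 : ℝ)) := fun x hx =>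
    ((B.mem_iff _).1 (snoc_mem_coneOver_iff.2 hx)).1
  have hmax : ∀ x ∈ P, f x ≤ f x₀ := by
    intro x hx
    rw [hfm, hfm, hm0, hm]
    have := Finset.sum_nonneg fun j (_ : j ∈ Finset.univ.erase i) => hnn x hx j
    linarith
  have hF : ({x₀} : Set (Fin n → ℝ)) = {z ∈ P | ∀ y ∈ P, f y ≤ f z} := by
    ext x
    constructor
    · rintro rfl
      exact ⟨hx₀, hmax⟩
    · rintro ⟨hx, hxm⟩
      have h1 := hxm x₀ hx₀
      rw [hfm, hfm, hm0] at h1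
      have h2 : latticePair m (Fin.snoc x (1 : ℝ)) = 0 := by
        refine le_antisymm (by linarith) ?_
        rw [hm]
        exact Finset.sum_nonneg fun j _ => hnn x hx j
      rw [hm, Finset.sum_eq_zero_iff_of_nonneg fun j _ => hnn x hx j] at h2
      have h3 := B.eq_sum (Fin.snoc x (1 : ℝ))
      rw [← Finset.add_sum_erase _ _ (Finset.mem_univ i), Finset.sum_eq_zero, add_zero] at h3
      · set t := latticePair (B.dual i) (Fin.snoc x (1 : ℝ))
        have h4 := congrFun h3 (Fin.last n)
        rw [Fin.snoc_last, Pi.smul_apply, smul_eq_mul] at h4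
        have h5 : t = h⁻¹ := eq_inv_of_mul_eq_one_left h4.symm
        rw [Set.mem_singleton_iff]
        ext j
        have h6 := congrFun h3 j.castSucc
        rw [Fin.snoc_castSucc, h5] at h6
        exact h6
      · intro j hj
        rw [h2 j hj, zero_smul]
  have hcell : ({x₀} : Set (Fin n → ℝ)) ∈ S.cells := S.face_mem P hP _ ⟨x₀, rfl⟩ fun _ =>
    ⟨LinearMap.toContinuousLinearMap f, hF⟩
  refine hS.2 (coneOver {x₀}) ⟨_, hcell, Or.inl rfl⟩ (B.gen i) ⟨fun k hk => ?_, ?_⟩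
  · have h1 : k ∣ B.dual i ⬝ᵥ B.gen i := Finset.dvd_sum fun j _ => (hk j).mul_left _
    rw [B.dual_dot_gen, if_pos rfl] at h1
    exact isUnit_of_dvd_one h1
  · ext y
    constructor
    · intro hy
      rcases (S.last_nonneg ⟨_, hcell, Or.inl rfl⟩ hy).eq_or_lt with hy0 | hy0
      · rw [mem_coneOver_iff_of_last_eq_zero hy0.symm] at hy
        have h1 : x₀ + Fin.init y = x₀ := hy x₀ rfl
        rw [add_eq_left] at h1
        refine ⟨0, le_rfl, fun j => ?_⟩
        rw [zero_mul]
        refine Fin.lastCases hy0.symm (fun j => ?_) j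
        exact congrFun h1 j
      · rw [mem_coneOver_iff_of_last_pos hy0, Set.mem_singleton_iff] at hy
        refine ⟨y (Fin.last n) * h⁻¹, by positivity, fun j => ?_⟩
        refine Fin.lastCases ?_ (fun j => ?_) j
        · exact (inv_mul_cancel_right₀ hgi _).symm
        · have h1 := congrFun hy j
          simp only [Pi.smul_apply, smul_eq_mul, x₀] at h1
          rw [inv_mul_eq_iff_eq_mul₀ hy0.ne', ← mul_assoc] at h1
          exact h1
    · rintro ⟨t, ht, hy⟩
      have hy' : y = t • realVec (B.gen i) := funext hy
      rcases ht.eq_or_lt with rfl | ht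
      · rw [hy', zero_smul, mem_coneOver_iff_of_last_eq_zero (by rfl)]
        exact zero_mem_recessionCone
      · have h1 : y (Fin.last n) = t * h := hy _
        rw [mem_coneOver_iff_of_last_pos (by rw [h1]; positivity), h1, hy', init_smul,
          smul_smul, mul_inv_rev, mul_assoc, inv_mul_cancel₀ ht.ne', mul_one]
        rfl

end PolyhedralSubdivision

/-! # Monomial coordinates on affine toric varieties -/

namespace ConeBasis

variable {N : ℕ} {τ σ : Set (Fin N → ℝ)} (B : ConeBasis τ)

/-- The Laurent monomial with exponent `m` in the coordinates given by the lattice basis. -/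
def monomial (z : Fin N → ℂ) (m : Fin N → ℤ) : ℂ := ∏ i, z i ^ (m ⬝ᵥ B.gen i)

/-- The coordinates of a point of the affine toric variety. -/
def coords (φ : AffineToric τ) : Fin N → ℂ := fun i => φ.1 ⟨B.dual i, B.dual_mem i⟩

theorem monomial_zero (z : Fin N → ℂ) : B.monomial z 0 = 1 := by
  simp [monomial]

/-- Vanishing coordinates must carry nonnegative exponents: `0 ^ (-1) * 0 ^ 1` is `0`, whereas `0 ^
0` is `1`. -/
theorem monomial_add {z : Fin N → ℂ} {m m' : Fin N → ℤ}
    (h : ∀ i, z i = 0 → 0 ≤ m ⬝ᵥ B.gen i ∧ 0 ≤ m' ⬝ᵥ B.gen i) :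
    B.monomial z (m + m') = B.monomial z m * B.monomial z m' := by
  rw [monomial, monomial, monomial, ← Finset.prod_mul_distrib]
  refine Finset.prod_congr rfl fun i _ => ?_
  rw [add_dotProduct]
  by_cases hz : z i = 0
  · obtain ⟨h1, h2⟩ := h i hz
    lift m ⬝ᵥ B.gen i to ℕ using h1 with a
    lift m' ⬝ᵥ B.gen i to ℕ using h2 with b
    rw [← Nat.cast_add, zpow_natCast, zpow_natCast, zpow_natCast, pow_add]
  · exact zpow_add₀ hz _ _

theorem monomial_ne_zero_iff {z : Fin N → ℂ} {m : Fin N → ℤ} :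
    B.monomial z m ≠ 0 ↔ ∀ i, z i = 0 → m ⬝ᵥ B.gen i = 0 := by
  simp only [monomial, Finset.prod_ne_zero_iff, Finset.mem_univ, true_implies]
  refine forall_congr' fun i => ?_
  by_cases hz : z i = 0
  · by_cases hm : m ⬝ᵥ B.gen i = 0
    · simp [hm]
    · simp [hz, hm, zero_zpow]
  · simp [hz, zpow_ne_zero]

theorem monomial_dual (z : Fin N → ℂ) (i : Fin N) : B.monomial z (B.dual i) = z i := by
  rw [monomial, Finset.prod_eq_single i]
  · rw [B.dual_dot_gen, if_pos rfl, zpow_one]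
  · intro j _ hj
    rw [B.dual_dot_gen, if_neg hj.symm, zpow_zero]
  · simp

/-- Both `dual i` and its negative lie in the semigroup, so the value is invertible. -/
theorem coords_ne_zero (φ : AffineToric τ) {i : Fin N} (hi : i ∉ B.supp) : B.coords φ i ≠ 0 := by
  intro h
  have h1 := φ.2.2 ⟨B.dual i, B.dual_mem i⟩ ⟨-B.dual i, B.neg_dual_mem hi⟩
  have h2 : (⟨B.dual i, B.dual_mem i⟩ + ⟨-B.dual i, B.neg_dual_mem hi⟩ : dualSemigroup τ) = 0 := by
    ext j
    simp
  rw [h2, φ.2.1] at h1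
  change φ.1 ⟨B.dual i, B.dual_mem i⟩ = 0 at h
  rw [h, zero_mul] at h1
  exact one_ne_zero h1

theorem mem_supp_of_coords_eq_zero {φ : AffineToric τ} {i : Fin N} (h : B.coords φ i = 0) :
    i ∈ B.supp := by
  by_contra hi
  exact B.coords_ne_zero φ hi h

theorem _root_.AffineToric.map_nsmul (φ : AffineToric τ) (k : ℕ) (a : dualSemigroup τ) :
    φ.1 (k • a) = φ.1 a ^ k := by
  induction k with
  | zero => simpa using φ.2.1
  | succ k ih => rw [succ_nsmul, φ.2.2, ih, pow_succ]

theorem _root_.AffineToric.map_sum (φ : AffineToric τ) {ι : Type*} (s : Finset ι)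
    (a : ι → dualSemigroup τ) : φ.1 (∑ i ∈ s, a i) = ∏ i ∈ s, φ.1 (a i) := by
  classical
  induction s using Finset.induction_on with
  | empty => simpa using φ.2.1
  | insert k s hk ih => rw [Finset.sum_insert hk, Finset.prod_insert hk, φ.2.2, ih]

theorem apply_zsmul_dual (φ : AffineToric τ) {i : Fin N} {c : ℤ}
    (hc : c • B.dual i ∈ dualSemigroup τ) (h : i ∈ B.supp → 0 ≤ c) :
    φ.1 ⟨c • B.dual i, hc⟩ = B.coords φ i ^ c := by
  by_cases h0 : 0 ≤ c
  · lift c to ℕ using h0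
    rw [zpow_natCast]
    have : (⟨(c : ℤ) • B.dual i, hc⟩ : dualSemigroup τ) = c • ⟨B.dual i, B.dual_mem i⟩ := by
      ext j
      simp
    rw [this, φ.map_nsmul]
    rfl
  · have hi : i ∉ B.supp := fun hi => h0 (h hi)
    obtain ⟨k, rfl⟩ : ∃ k : ℕ, c = -k := ⟨c.natAbs, by omega⟩
    have h1 : (⟨-(k : ℤ) • B.dual i, hc⟩ : dualSemigroup τ) + k • ⟨B.dual i, B.dual_mem i⟩ = 0 := by
      ext j
      simp
    have h2 := φ.2.2 ⟨-(k : ℤ) • B.dual i, hc⟩ (k • ⟨B.dual i, B.dual_mem i⟩)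
    rw [h1, φ.2.1, φ.map_nsmul] at h2
    rw [zpow_neg, zpow_natCast]
    exact eq_inv_of_mul_eq_one_left h2.symm

/-- Each term of the expansion of `m` in the dual basis already lies in the semigroup, so the values
on the dual vectors determine the homomorphism. -/
theorem apply_eq_monomial (φ : AffineToric τ) (m : dualSemigroup τ) :
    φ.1 m = B.monomial (B.coords φ) m.1 := by
  have hm := (B.mem_dualSemigroup_iff m.1).1 m.2
  have hmem : ∀ i, (m.1 ⬝ᵥ B.gen i) • B.dual i ∈ dualSemigroup τ := by
    intro i
    rw [B.mem_dualSemigroup_iff]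
    intro j hj
    rw [smul_dotProduct, B.dual_dot_gen]
    split_ifs with hij
    · subst hij
      simpa using hm i hj
    · simp
  have h1 : m = ∑ i, ⟨(m.1 ⬝ᵥ B.gen i) • B.dual i, hmem i⟩ := by
    apply Subtype.ext
    rw [AddSubmonoid.coe_finsetSum]
    exact B.expand m.1
  conv_lhs => rw [h1]
  rw [φ.map_sum]
  exact Finset.prod_congr rfl fun i _ => B.apply_zsmul_dual φ _ fun hi => hm i hi

/-- The point of `U_σ` with given coordinates with respect to a basis that belongs to `τ`. -/
def point (σ : Set (Fin N → ℝ)) (z : Fin N → ℂ) (h : ∀ i, z i = 0 → realVec (B.gen i) ∈ σ) :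
    AffineToric σ :=
  ⟨fun m => B.monomial z m.1, B.monomial_zero z, fun a b => B.monomial_add fun i hi => by
    have key : ∀ m : dualSemigroup σ, 0 ≤ m.1 ⬝ᵥ B.gen i := fun m => by
      have : 0 ≤ latticePair m.1 (realVec (B.gen i)) := m.2 _ (h i hi)
      rw [latticePair_realVec] at this
      exact_mod_cast this
    exact ⟨key a, key b⟩⟩

theorem dot_nonneg_of_mem {m : Fin N → ℤ} (hm : m ∈ dualSemigroup σ) {i : Fin N}
    (hi : realVec (B.gen i) ∈ σ) : 0 ≤ m ⬝ᵥ B.gen i := by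
  have : 0 ≤ latticePair m (realVec (B.gen i)) := hm _ hi
  rw [latticePair_realVec] at this
  exact_mod_cast this

theorem coords_point (z : Fin N → ℂ) (h : ∀ i, z i = 0 → realVec (B.gen i) ∈ τ) :
    B.coords (B.point τ z h) = z := by
  ext i
  exact B.monomial_dual z i

theorem point_coords (φ : AffineToric τ)
    (h : ∀ i, B.coords φ i = 0 → realVec (B.gen i) ∈ τ) : B.point τ (B.coords φ) h = φ := by
  apply Subtype.ext
  funext m
  exact (B.apply_eq_monomial φ m).symm

theorem analyticAt_monomial {z : Fin N → ℂ} {m : Fin N → ℤ}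
    (h : ∀ i, z i = 0 → 0 ≤ m ⬝ᵥ B.gen i) : AnalyticAt ℂ (fun w => B.monomial w m) z := by
  unfold monomial
  refine Finset.analyticAt_fun_prod _ fun i _ => ?_
  have h1 : AnalyticAt ℂ (fun w : Fin N → ℂ => w i) z :=
    (ContinuousLinearMap.proj (R := ℂ) (φ := fun _ : Fin N => ℂ) i).analyticAt z
  by_cases hz : z i = 0
  · exact h1.fun_zpow_nonneg (h i hz)
  · exact h1.fun_zpow hz

theorem continuous_coords : Continuous B.coords :=
  continuous_pi fun i => (continuous_apply (⟨B.dual i, B.dual_mem i⟩ : dualSemigroup τ)).comp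
    continuous_subtype_val

theorem continuous_point {Y : Type*} [TopologicalSpace Y] {f : Y → Fin N → ℂ} (hf : Continuous f)
    (h : ∀ y i, f y i = 0 → realVec (B.gen i) ∈ σ) :
    Continuous fun y => B.point σ (f y) (h y) := by
  refine Continuous.subtype_mk (continuous_pi fun m => ?_) _
  rw [continuous_iff_continuousAt]
  intro y
  exact ContinuousAt.comp (f := f) (B.analyticAt_monomial fun i hi =>
    B.dot_nonneg_of_mem m.2 (h y i hi)).continuousAt hf.continuousAt

/-- The image of the coordinates on `U_τ`. -/
def coordSet : Set (Fin N → ℂ) := {z | ∀ i, z i = 0 → i ∈ B.supp}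

theorem isOpen_coordSet : IsOpen B.coordSet := by
  have : B.coordSet = ⋂ i, {z | z i = 0 → i ∈ B.supp} := by
    ext z
    simp [coordSet]
  rw [this]
  refine isOpen_iInter_of_finite fun i => ?_
  by_cases hi : i ∈ B.supp
  · simp [hi]
  · simp only [hi, imp_false]
    exact isOpen_ne.preimage (continuous_apply i)

/-- The affine toric variety of a unimodular cone is an open subset of affine space. -/
def coordHomeomorph : B.coordSet ≃ₜ AffineToric τ where
  toFun z := B.point τ z.1 fun i hi => B.gen_mem (z.2 i hi)
  invFun φ := ⟨B.coords φ, fun _ hi => B.mem_supp_of_coords_eq_zero hi⟩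
  left_inv z := Subtype.ext (B.coords_point z.1 fun i hi => B.gen_mem (z.2 i hi))
  right_inv φ := B.point_coords φ _
  continuous_toFun := B.continuous_point continuous_subtype_val _
  continuous_invFun := B.continuous_coords.subtype_mk _

end ConeBasis

/-- The graph of the extension of `φ` to fractions of monomials. -/
def fractionGraph {N : ℕ} {τ : Set (Fin N → ℝ)} (φ : AffineToric τ) : Set ((Fin N → ℤ) × ℂ) :=
  {p | ∃ a b : dualSemigroup τ, p.1 = a.1 - b.1 ∧ φ.1 b ≠ 0 ∧ φ.1 a = p.2 * φ.1 b}

/-- A denominator with nonzero value has exponent `0` in every vanishing coordinate, so dividing by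
it is harmless. -/
theorem ConeBasis.of_mem_fractionGraph {N : ℕ} {τ : Set (Fin N → ℝ)} (B : ConeBasis τ)
    {φ : AffineToric τ} {m : Fin N → ℤ} {c : ℂ} (h : (m, c) ∈ fractionGraph φ) :
    (∀ i, B.coords φ i = 0 → 0 ≤ m ⬝ᵥ B.gen i) ∧ c = B.monomial (B.coords φ) m := by
  obtain ⟨a, b, rfl, hb, hab⟩ := h
  rw [B.apply_eq_monomial] at hb
  rw [B.apply_eq_monomial φ a, B.apply_eq_monomial φ b] at hab
  have hb' := B.monomial_ne_zero_iff.1 hb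
  have h1 : ∀ i, B.coords φ i = 0 → 0 ≤ (a.1 - b.1) ⬝ᵥ B.gen i := by
    intro i hi
    rw [sub_dotProduct, hb' i hi, sub_zero]
    exact (B.mem_dualSemigroup_iff a.1).1 a.2 i (B.mem_supp_of_coords_eq_zero hi)
  refine ⟨h1, ?_⟩
  refine mul_right_cancel₀ hb ?_
  rw [← B.monomial_add fun i hi => ⟨h1 i hi, (hb' i hi).ge⟩, sub_add_cancel]
  exact hab.symm

/-! # The topology of the toric variety -/

namespace PolyhedralSubdivision

variable {n : ℕ} {S : PolyhedralSubdivision n}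

/-- The smaller chart is the localisation of the larger one at a monomial `u` cutting out the
smaller cone: `u` is invertible there, and adding a large multiple of `u` moves any exponent into
the larger cone's semigroup. Numerator and denominator are multiplied by the same power. -/
theorem IsUnimodular.fractionGraph_eq (hS : S.IsUnimodular) {a b : Σ τ : S.fan, AffineToric τ.1}
    (h : S.Glue a b) : fractionGraph a.2 = fractionGraph b.2 := by
  obtain ⟨hsub, hab⟩ := h
  obtain ⟨B⟩ := (hS b.1.1 b.1.2).nonempty_coneBasis
  obtain ⟨u, hu, hu', hu0, -⟩ := hS.exists_separating b.1.2 a.1.2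
  have hua : u ∈ dualSemigroup a.1.1 := dualSemigroup_anti hsub hu
  have hune : a.2.1 ⟨u, hua⟩ ≠ 0 := by
    intro h0
    have h1 := a.2.2.2 ⟨u, hua⟩ ⟨-u, hu'⟩
    have h2 : (⟨u, hua⟩ + ⟨-u, hu'⟩ : dualSemigroup a.1.1) = 0 := by
      ext j
      simp
    rw [h2, a.2.2.1, h0, zero_mul] at h1
    exact one_ne_zero h1
  have hshift : ∀ m : dualSemigroup a.1.1, ∃ k₀ : ℕ, ∀ k ≥ k₀,
      m.1 + k • u ∈ dualSemigroup b.1.1 := by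
    intro m
    refine ⟨∑ i, (m.1 ⬝ᵥ B.gen i).natAbs, fun k hk => ?_⟩
    rw [B.mem_dualSemigroup_iff]
    intro i hi
    rw [add_dotProduct, smul_dotProduct, nsmul_eq_mul]
    rcases ((B.mem_dualSemigroup_iff u).1 hu i hi).eq_or_lt with h0 | h0
    · rw [← h0, mul_zero, add_zero]
      refine B.dot_nonneg_of_mem m.2 (hu0 _ (B.gen_mem hi) ?_)
      rw [latticePair_realVec, ← h0, Int.cast_zero]
    · have h1 : (m.1 ⬝ᵥ B.gen i).natAbs ≤ k :=
        (Finset.single_le_sum (f := fun i => (m.1 ⬝ᵥ B.gen i).natAbs)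
          (fun _ _ => Nat.zero_le _) (Finset.mem_univ i)).trans hk
      have h2 : (k : ℤ) * 1 ≤ k * (u ⬝ᵥ B.gen i) :=
        mul_le_mul_of_nonneg_left (by omega) (by omega)
      omega
  ext ⟨m, c⟩
  constructor
  · rintro ⟨x, y, hm, hy, hxy⟩
    obtain ⟨k₁, hk₁⟩ := hshift x
    obtain ⟨k₂, hk₂⟩ := hshift y
    have hx' := hk₁ (max k₁ k₂) (le_max_left _ _)
    have hy' := hk₂ (max k₁ k₂) (le_max_right _ _)
    have key : ∀ (x : dualSemigroup a.1.1) (k : ℕ) (h : x.1 + k • u ∈ dualSemigroup b.1.1),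
        b.2.1 ⟨x.1 + k • u, h⟩ = a.2.1 x * a.2.1 ⟨u, hua⟩ ^ k := by
      intro x k h
      rw [hab, ← AffineToric.map_nsmul, ← a.2.2.2]
      congr 1
    refine ⟨⟨_, hx'⟩, ⟨_, hy'⟩, ?_, ?_, ?_⟩
    · simpa using hm
    · rw [key]
      exact mul_ne_zero hy (pow_ne_zero _ hune)
    · rw [key, key, hxy]
      ring
  · rintro ⟨x, y, hm, hy, hxy⟩
    refine ⟨⟨x.1, dualSemigroup_anti hsub x.2⟩, ⟨y.1, dualSemigroup_anti hsub y.2⟩, hm, ?_, ?_⟩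
    · rwa [← hab]
    · rw [← hab, ← hab]
      exact hxy

/-- Equality in the quotient is a chain of gluings, but `fractionGraph` is constant along it. Every
monomial of `σ^∨` thus has a value at `φ`, so its exponents in vanishing coordinates are
nonnegative; biduality puts the corresponding generators in `σ`. -/
theorem IsUnimodular.of_toricMk_eq (hS : S.IsUnimodular) {τ σ : S.fan} (B : ConeBasis τ.1)
    {φ : AffineToric τ.1} {ψ : AffineToric σ.1} (h : S.toricMk τ φ = S.toricMk σ ψ) :
    (∀ i, B.coords φ i = 0 → realVec (B.gen i) ∈ σ.1) ∧
      ∀ m : dualSemigroup σ.1, ψ.1 m = B.monomial (B.coords φ) m.1 := by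
  have hg : fractionGraph φ = fractionGraph ψ := congrArg
    (Quot.lift (fun a : Σ τ : S.fan, AffineToric τ.1 => fractionGraph a.2)
      fun _ _ => hS.fractionGraph_eq) h
  have key : ∀ m : dualSemigroup σ.1, (m.1, ψ.1 m) ∈ fractionGraph φ := by
    intro m
    rw [hg]
    refine ⟨m, 0, ?_, ?_, ?_⟩
    · simp
    · rw [ψ.2.1]
      exact one_ne_zero
    · rw [ψ.2.1, mul_one]
  refine ⟨fun i hi => ?_, fun m => (B.of_mem_fractionGraph (key m)).2⟩
  obtain ⟨B'⟩ := (hS σ.1 σ.2).nonempty_coneBasis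
  refine B'.mem_of_forall_dual fun m hm => ?_
  rw [latticePair_realVec]
  exact_mod_cast (B.of_mem_fractionGraph (key ⟨m, hm⟩)).1 i hi

theorem IsUnimodular.toricMk_injective (hS : S.IsUnimodular) (τ : S.fan) :
    Function.Injective (S.toricMk τ) := by
  intro φ ψ h
  obtain ⟨B⟩ := (hS τ.1 τ.2).nonempty_coneBasis
  apply Subtype.ext
  funext m
  rw [B.apply_eq_monomial φ m, (hS.of_toricMk_eq B h).2 m]

/-- Gluing links nested cones only, so the passage from `τ` to `σ` goes through the chart of `τ ∩
σ`. -/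
theorem IsUnimodular.toricMk_point (hS : S.IsUnimodular) {τ : S.fan} (σ : S.fan)
    (B : ConeBasis τ.1) (φ : AffineToric τ.1)
    (h : ∀ i, B.coords φ i = 0 → realVec (B.gen i) ∈ σ.1) :
    S.toricMk σ (B.point σ.1 (B.coords φ) h) = S.toricMk τ φ := by
  let γ : S.fan := ⟨τ.1 ∩ σ.1, hS.inter_mem_fan τ.2 σ.2⟩
  let χ : AffineToric γ.1 := B.point γ.1 (B.coords φ) fun i hi =>
    ⟨B.gen_mem (B.mem_supp_of_coords_eq_zero hi), h i hi⟩
  have h1 : S.toricMk γ χ = S.toricMk τ φ :=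
    Quot.sound ⟨Set.inter_subset_left, fun m => B.apply_eq_monomial φ m⟩
  have h2 : S.toricMk γ χ = S.toricMk σ (B.point σ.1 (B.coords φ) h) :=
    Quot.sound ⟨Set.inter_subset_right, fun m => rfl⟩
  rw [← h1, ← h2]

theorem continuous_toricMk (τ : S.fan) : Continuous (S.toricMk τ) :=
  continuous_quot_mk.comp continuous_sigmaMk

theorem IsUnimodular.isOpenMap_toricMk (hS : S.IsUnimodular) (σ : S.fan) :
    IsOpenMap (S.toricMk σ) := by
  intro U hU
  rw [← isQuotientMap_quot_mk.isOpen_preimage, isOpen_sigma_iff]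
  intro τ
  obtain ⟨B⟩ := (hS τ.1 τ.2).nonempty_coneBasis
  -- `W` is the overlap with `U_σ` inside `U_τ`, and `r` below is the transition map on it.
  let W : Set (AffineToric τ.1) := {φ | ∀ i, B.coords φ i = 0 → realVec (B.gen i) ∈ σ.1}
  have hW : IsOpen W := by
    have : W = ⋂ i, {φ | B.coords φ i = 0 → realVec (B.gen i) ∈ σ.1} := by
      ext φ
      simp [W]
    rw [this]
    refine isOpen_iInter_of_finite fun i => ?_
    by_cases hi : realVec (B.gen i) ∈ σ.1
    · simp [hi]
    · simp only [hi, imp_false]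
      exact isOpen_ne.preimage ((continuous_apply i).comp B.continuous_coords)
  let r : W → AffineToric σ.1 := fun φ => B.point σ.1 (B.coords φ.1) φ.2
  have hr : Continuous r :=
    B.continuous_point (B.continuous_coords.comp continuous_subtype_val) fun φ => φ.2
  convert hW.isOpenMap_subtype_val _ (hU.preimage hr) using 1
  ext φ
  constructor
  · rintro ⟨ψ, hψ, h⟩
    have h1 := hS.of_toricMk_eq B h.symm
    refine ⟨⟨φ, h1.1⟩, ?_, rfl⟩
    have : r ⟨φ, h1.1⟩ = ψ := Subtype.ext (funext fun m => (h1.2 m).symm)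
    rw [Set.mem_preimage, this]
    exact hψ
  · rintro ⟨⟨φ', hφ'⟩, h, rfl⟩
    exact ⟨_, h, hS.toricMk_point σ B φ' hφ'⟩

theorem IsUnimodular.isOpenEmbedding_toricMk (hS : S.IsUnimodular) (τ : S.fan) :
    Topology.IsOpenEmbedding (S.toricMk τ) :=
  .of_continuous_injective_isOpenMap (continuous_toricMk τ) (hS.toricMk_injective τ)
    (hS.isOpenMap_toricMk τ)

theorem exists_toricMk (x : S.ToricVariety) : ∃ τ φ, S.toricMk τ φ = x := by
  induction x using Quot.ind with
  | mk a => exact ⟨a.1, a.2, rfl⟩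

theorem finite_fan (S : PolyhedralSubdivision n) : S.fan.Finite := by
  have : S.fan = coneOver '' S.cells ∪ levelZeroCone '' S.cells := by
    ext τ
    simp only [fan, Set.mem_ofPred_eq, Set.mem_union, Set.mem_image]
    constructor
    · rintro ⟨P, hP, rfl | rfl⟩
      · exact Or.inl ⟨P, hP, rfl⟩
      · exact Or.inr ⟨P, hP, rfl⟩
    · rintro (⟨P, hP, rfl⟩ | ⟨P, hP, rfl⟩)
      · exact ⟨P, hP, Or.inl rfl⟩
      · exact ⟨P, hP, Or.inr rfl⟩
  rw [this]
  exact (S.finite.image _).union (S.finite.image _)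

theorem IsUnimodular.secondCountableTopology (hS : S.IsUnimodular) :
    SecondCountableTopology S.ToricVariety := by
  have : Finite S.fan := S.finite_fan
  have : ∀ τ : S.fan, SecondCountableTopology (Set.range (S.toricMk τ)) := fun τ => by
    obtain ⟨B⟩ := (hS τ.1 τ.2).nonempty_coneBasis
    exact (B.coordHomeomorph.trans
      (hS.isOpenEmbedding_toricMk τ).isEmbedding.toHomeomorph).symm.isEmbedding.secondCountableTopology
  refine TopologicalSpace.secondCountableTopology_of_countable_cover
    (fun τ : S.fan => (hS.isOpenMap_toricMk τ).isOpen_range) ?_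
  refine Set.eq_univ_of_forall fun x => ?_
  obtain ⟨τ, φ, rfl⟩ := exists_toricMk x
  exact Set.mem_iUnion_of_mem τ ⟨φ, rfl⟩

/-- Let one ultrafilter converge to points of `U_τ` and `U_σ`. For a separating form `u`, the values
of `u` in the first chart and of `-u` in the second multiply to `1` along it, hence also in the
limit. So `u` does not vanish at the first limit, which then lies in `U_σ`, and limits in this
single Hausdorff chart agree. -/
theorem IsUnimodular.t2Space (hS : S.IsUnimodular) : T2Space S.ToricVariety := by
  rw [t2_iff_ultrafilter]
  intro x y f hx hy
  obtain ⟨τ, φ, rfl⟩ := exists_toricMk x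
  obtain ⟨σ, ψ, rfl⟩ := exists_toricMk y
  obtain ⟨B⟩ := (hS τ.1 τ.2).nonempty_coneBasis
  obtain ⟨u, hu, hu', hu0, -⟩ := hS.exists_separating τ.2 σ.2
  have hr : ∀ (τ : S.fan) (φ : AffineToric τ.1), (f : Filter S.ToricVariety) ≤ nhds (S.toricMk τ φ) →
      ∃ r : S.ToricVariety → AffineToric τ.1, Filter.Tendsto r f (nhds φ) ∧
        ∀ᶠ x in (f : Filter S.ToricVariety), S.toricMk τ (r x) = x := by
    intro τ φ hf
    have : Nonempty (AffineToric τ.1) := ⟨φ⟩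
    refine ⟨Function.invFun (S.toricMk τ), Filter.Tendsto.mono_left ?_ hf, hf ?_⟩
    · rw [← (hS.isOpenEmbedding_toricMk τ).map_nhds_eq, Filter.tendsto_map'_iff]
      rw [Function.invFun_comp (hS.toricMk_injective τ)]
      exact Filter.tendsto_id
    · filter_upwards [(hS.isOpenMap_toricMk τ).isOpen_range.mem_nhds ⟨φ, rfl⟩] with x hx
      exact Function.invFun_eq hx
  have hev : ∀ (τ : S.fan) (m : dualSemigroup τ.1), Continuous fun φ : AffineToric τ.1 => φ.1 m :=
    fun τ m => (continuous_apply m).comp continuous_subtype_val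
  obtain ⟨r, hr1, hr2⟩ := hr τ φ hx
  obtain ⟨r', hr1', hr2'⟩ := hr σ ψ hy
  have hone : φ.1 ⟨u, hu⟩ * ψ.1 ⟨-u, hu'⟩ = 1 := by
    have h1 := (((hev τ ⟨u, hu⟩).tendsto φ).comp hr1).mul
      (((hev σ ⟨-u, hu'⟩).tendsto ψ).comp hr1')
    refine tendsto_nhds_unique h1 (tendsto_const_nhds.congr' ?_)
    filter_upwards [hr2, hr2'] with x h2 h2'
    obtain ⟨h3, h4⟩ := hS.of_toricMk_eq B (h2.trans h2'.symm)
    change 1 = (r x).1 ⟨u, hu⟩ * (r' x).1 ⟨-u, hu'⟩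
    rw [h4, B.apply_eq_monomial, ← B.monomial_add, add_neg_cancel, B.monomial_zero]
    intro i hi
    exact ⟨(B.mem_dualSemigroup_iff u).1 hu i (B.mem_supp_of_coords_eq_zero hi),
      B.dot_nonneg_of_mem hu' (h3 i hi)⟩
  have hφσ : ∀ i, B.coords φ i = 0 → realVec (B.gen i) ∈ σ.1 := by
    intro i hi
    refine hu0 _ (B.gen_mem (B.mem_supp_of_coords_eq_zero hi)) ?_
    have h1 := left_ne_zero_of_mul_eq_one hone
    rw [B.apply_eq_monomial, B.monomial_ne_zero_iff] at h1
    rw [latticePair_realVec, h1 i hi, Int.cast_zero]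
  have hmk := hS.toricMk_point σ B φ hφσ
  rw [← hmk] at hx ⊢
  obtain ⟨r'', hr1'', hr2''⟩ := hr σ _ hx
  congr 1
  refine tendsto_nhds_unique hr1'' (hr1'.congr' ?_)
  filter_upwards [hr2', hr2''] with x h2 h2'
  exact hS.toricMk_injective σ (h2.trans h2'.symm)

theorem toricProj_toricMk (τ : S.fan) (φ : AffineToric τ.1) :
    S.toricProj (S.toricMk τ φ) = φ.1 (S.lastForm τ) := rfl

theorem toricConj_toricMk (τ : S.fan) (φ : AffineToric τ.1) :
    S.toricConj (S.toricMk τ φ) = S.toricMk τ (affineConj φ) := rfl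

/-! # Properness of the projection -/

/-- Tychonoff: a product of closed discs, cut by the closed conditions of a semigroup homomorphism.
-/
theorem isCompact_setOf_norm_le {N : ℕ} {τ : Set (Fin N → ℝ)} (r : dualSemigroup τ → ℝ) :
    IsCompact {φ : AffineToric τ | ∀ m, ‖φ.1 m‖ ≤ r m} := by
  rw [Subtype.isCompact_iff]
  have hK : IsCompact (Set.univ.pi fun m : dualSemigroup τ => Metric.closedBall (0 : ℂ) (r m)) :=
    isCompact_univ_pi fun m => isCompact_closedBall _ _
  have hC : IsClosed {φ : dualSemigroup τ → ℂ | φ 0 = 1 ∧ ∀ a b, φ (a + b) = φ a * φ b} := by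
    have h2 : IsClosed {φ : dualSemigroup τ → ℂ | ∀ a b, φ (a + b) = φ a * φ b} := by
      simp only [Set.ofPred_forall]
      exact isClosed_iInter fun a => isClosed_iInter fun b =>
        isClosed_eq (by fun_prop) (by fun_prop)
    exact (isClosed_eq (continuous_apply _) continuous_const).inter h2
  convert hK.inter_right hC using 1
  ext φ
  constructor
  · rintro ⟨φ, hφ, rfl⟩
    exact ⟨fun m _ => by simpa using hφ m, φ.2⟩
  · rintro ⟨h1, h2⟩
    exact ⟨⟨φ, h2⟩, fun m => by simpa using h1 m trivial, rfl⟩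

variable (S) in
/-- A compact set that contains the part of the toric variety over the open disc of radius `R`. -/
def boundedPart (R : ℝ) : Set S.ToricVariety :=
  ⋃ τ : S.fan, S.toricMk τ '' {φ | ∀ m, ‖φ.1 m‖ ≤ R ^ m.1 (Fin.last n)}

theorem isCompact_boundedPart (R : ℝ) : IsCompact (S.boundedPart R) := by
  have : Finite S.fan := S.finite_fan
  exact isCompact_iUnion fun τ => (isCompact_setOf_norm_le _).image (continuous_toricMk τ)

/-- Logarithms of absolute values turn monomials on the torus into linear forms at one vector of
`ℝᴺ`. -/
theorem norm_monomial {N : ℕ} {τ : Set (Fin N → ℝ)} (B : ConeBasis τ) {z : Fin N → ℂ}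
    (hz : ∀ i, z i ≠ 0) (m : Fin N → ℤ) : ‖B.monomial z m‖
      = Real.exp (latticePair m (∑ i, Real.log ‖z i‖ • realVec (B.gen i))) := by
  rw [ConeBasis.monomial, norm_prod, latticePair_sum_right, Real.exp_sum]
  refine Finset.prod_congr rfl fun i _ => ?_
  rw [latticePair_smul_right, latticePair_realVec, norm_zpow, ← Real.rpow_intCast,
    Real.rpow_def_of_pos (norm_pos_iff.2 (hz i))]

/-- The bound on `π` says that `w` has nonnegative last coordinate, so some cone `σ` contains it.
For `m ∈ σ^∨`, the inequality `0 ≤ latticePair m w` is the logarithm of the required bound on the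
monomial `m`. -/
theorem IsUnimodular.mem_boundedPart_of_ne_zero (hS : S.IsUnimodular) {R : ℝ} (hR : 0 < R)
    {τ : S.fan} (B : ConeBasis τ.1) {φ : AffineToric τ.1} (hφ : ∀ i, B.coords φ i ≠ 0)
    (h : ‖S.toricProj (S.toricMk τ φ)‖ ≤ R) : S.toricMk τ φ ∈ S.boundedPart R := by
  set y : Fin (n + 1) → ℝ := ∑ i, Real.log ‖B.coords φ i‖ • realVec (B.gen i) with hy
  have hnorm := norm_monomial B hφ
  rw [← hy] at hnorm
  let w : Fin (n + 1) → ℝ := Real.log R • Pi.single (Fin.last n) 1 - y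
  have hw : ∀ m : Fin (n + 1) → ℤ,
      latticePair m w = Real.log R * m (Fin.last n) - latticePair m y := by
    intro m
    simp [w, latticePair, mul_sub, Finset.sum_sub_distrib, Pi.single_apply, mul_comm]
  have hwlast : 0 ≤ w (Fin.last n) := by
    rw [toricProj_toricMk, B.apply_eq_monomial, hnorm] at h
    rw [← Real.le_log_iff_exp_le hR] at h
    rw [← latticePair_single (Fin.last n) w, hw, Pi.single_eq_same, Int.cast_one, mul_one]
    exact sub_nonneg.2 h
  obtain ⟨σ, hσ, hwσ⟩ := S.exists_mem_fan hwlast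
  have hz : ∀ i, B.coords φ i = 0 → realVec (B.gen i) ∈ σ := fun i hi => absurd hi (hφ i)
  rw [← hS.toricMk_point ⟨σ, hσ⟩ B φ hz]
  refine Set.mem_iUnion_of_mem ⟨σ, hσ⟩ ⟨_, fun m => ?_, rfl⟩
  change ‖B.monomial (B.coords φ) m.1‖ ≤ _
  rw [hnorm, ← Real.rpow_intCast, Real.rpow_def_of_pos hR, Real.exp_le_exp]
  have h1 : 0 ≤ latticePair m.1 w := m.2 w hwσ
  rw [hw] at h1
  linarith

/-- Replacing vanishing coordinates by `1 / (k + 1)` approximates the point by torus points. The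
strict inequality persists for them, and the compact set is closed because the space is Hausdorff.
-/
theorem IsUnimodular.mem_boundedPart (hS : S.IsUnimodular) {R : ℝ} (hR : 0 < R)
    {x : S.ToricVariety} (h : ‖S.toricProj x‖ < R) : x ∈ S.boundedPart R := by
  have := hS.t2Space
  obtain ⟨τ, φ, rfl⟩ := exists_toricMk x
  obtain ⟨B⟩ := (hS τ.1 τ.2).nonempty_coneBasis
  let z : ℕ → B.coordSet := fun k =>
    ⟨fun i => if B.coords φ i = 0 then ((k + 1 : ℕ) : ℂ)⁻¹ else B.coords φ i, fun i hi => by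
      by_contra h'
      simp [B.coords_ne_zero φ h'] at hi⟩
  have hz : ∀ k i, (z k).1 i ≠ 0 := by
    intro k i
    change (if B.coords φ i = 0 then ((k + 1 : ℕ) : ℂ)⁻¹ else B.coords φ i) ≠ 0
    split_ifs with h'
    · exact inv_ne_zero (by exact_mod_cast k.succ_ne_zero)
    · exact h'
  have hlim : Filter.Tendsto z Filter.atTop (nhds (B.coordHomeomorph.symm φ)) := by
    rw [tendsto_subtype_rng, tendsto_pi_nhds]
    intro i
    change Filter.Tendsto
      (fun k : ℕ => if B.coords φ i = 0 then ((k + 1 : ℕ) : ℂ)⁻¹ else B.coords φ i) _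
      (nhds (B.coords φ i))
    split_ifs with h'
    · rw [h']
      exact (tendsto_inv_atTop_nhds_zero_nat (𝕜 := ℂ)).comp (Filter.tendsto_add_atTop_nat 1)
    · exact tendsto_const_nhds
  have hlim' : Filter.Tendsto (fun k => S.toricMk τ (B.coordHomeomorph (z k))) Filter.atTop
      (nhds (S.toricMk τ φ)) := by
    have h1 := ((continuous_toricMk τ).comp B.coordHomeomorph.continuous).tendsto
      (B.coordHomeomorph.symm φ)
    rw [Function.comp_apply, Homeomorph.apply_symm_apply] at h1
    exact h1.comp hlim
  refine (isCompact_boundedPart R).isClosed.mem_of_tendsto hlim' ?_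
  have hop : IsOpen {x : S.ToricVariety | ‖S.toricProj x‖ < R} :=
    isOpen_lt S.continuous_toricProj.norm continuous_const
  filter_upwards [hlim'.eventually (hop.mem_nhds h)] with k hk
  refine hS.mem_boundedPart_of_ne_zero hR B (fun i => ?_) (le_of_lt hk)
  have : B.coords (B.coordHomeomorph (z k)) = (z k).1 :=
    B.coords_point (z k).1 fun i hi => absurd hi (hz k i)
  rw [this]
  exact hz k i

theorem IsUnimodular.isCompact_preimage_toricProj (hS : S.IsUnimodular) {K : Set ℂ}
    (hK : IsCompact K) : IsCompact (S.toricProj ⁻¹' K) := by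
  obtain ⟨R, hR0, hR⟩ := hK.isBounded.exists_pos_norm_lt
  exact (isCompact_boundedPart R).of_isClosed_subset (hK.isClosed.preimage S.continuous_toricProj)
    fun x hx => hS.mem_boundedPart hR0 (hR _ hx)

/-! ### Complex conjugation on the toric variety -/

theorem _root_.continuous_affineConj {N : ℕ} {τ : Set (Fin N → ℝ)} :
    Continuous (affineConj : AffineToric τ → AffineToric τ) := by
  have h : ∀ m, Continuous fun φ : AffineToric τ => φ.1 m := fun m =>
    (continuous_apply m).comp continuous_subtype_val
  exact Continuous.subtype_mk (continuous_pi fun m => Complex.continuous_conj.comp (h m)) _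

theorem continuous_toricConj : Continuous S.toricConj :=
  continuous_quot_lift _ (continuous_sigma fun τ =>
    (continuous_toricMk τ).comp continuous_affineConj)

theorem involutive_toricConj : Function.Involutive S.toricConj := by
  intro x
  obtain ⟨τ, φ, rfl⟩ := exists_toricMk x
  rw [toricConj_toricMk, toricConj_toricMk]
  congr 1
  apply Subtype.ext
  funext m
  exact Complex.conj_conj _

end PolyhedralSubdivision

/-! # The complex structure of the toric variety -/

instance ConeBasis.nonempty_coordSet {N : ℕ} {τ : Set (Fin N → ℝ)} (B : ConeBasis τ) :
    Nonempty B.coordSet := ⟨⟨fun _ => 1, fun _ hi => absurd hi one_ne_zero⟩⟩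

/-- The target has dimension one, so by the chain rule a single curve with nonzero velocity after
`f` suffices. -/
theorem surjective_mfderiv_of_curve {d : ℕ} {X : Type*} [TopologicalSpace X]
    [ChartedSpace (Fin d → ℂ) X] {f : X → ℂ} {h : ℂ → X} {t c : ℂ}
    (hf : MDifferentiableAt 𝓘(ℂ, Fin d → ℂ) 𝓘(ℂ, ℂ) f (h t))
    (hh : MDifferentiableAt 𝓘(ℂ, ℂ) 𝓘(ℂ, Fin d → ℂ) h t) (hc : c ≠ 0)
    (hd : HasDerivAt (f ∘ h) c t) :
    Function.Surjective (mfderiv 𝓘(ℂ, Fin d → ℂ) 𝓘(ℂ, ℂ) f (h t)) := by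
  intro w
  let w' : ℂ := w
  refine ⟨mfderiv 𝓘(ℂ, ℂ) 𝓘(ℂ, Fin d → ℂ) h t (w' / c : ℂ), ?_⟩
  have h1 := mfderiv_comp t hf hh
  rw [mfderiv_eq_fderiv] at h1
  have h2 : fderiv ℂ (f ∘ h) t (w' / c) = w' := by
    rw [hd.hasFDerivAt.fderiv]
    simp [hc]
  rw [h1] at h2
  exact h2

namespace PolyhedralSubdivision

variable {n : ℕ} {S : PolyhedralSubdivision n}

/-- The chart of the toric variety given by monomial coordinates on `U_τ`. -/
def toricChart (hS : S.IsUnimodular) (τ : S.fan) (B : ConeBasis τ.1) :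
    OpenPartialHomeomorph S.ToricVariety (Fin (n + 1) → ℂ) :=
  (((hS.isOpenEmbedding_toricMk τ).comp
      B.coordHomeomorph.isOpenEmbedding).toOpenPartialHomeomorph _).symm.trans
    (B.isOpen_coordSet.isOpenEmbedding_subtypeVal.toOpenPartialHomeomorph _)

section Chart

variable (hS : S.IsUnimodular) {τ σ : S.fan} (B : ConeBasis τ.1) (B' : ConeBasis σ.1)

theorem toricChart_source : (toricChart hS τ B).source = Set.range (S.toricMk τ) := by
  simp [toricChart, Set.range_comp]

theorem toricMk_mem_source (φ : AffineToric τ.1) :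
    S.toricMk τ φ ∈ (toricChart hS τ B).source := by
  rw [toricChart_source]
  exact ⟨φ, rfl⟩

theorem toricChart_toricMk (φ : AffineToric τ.1) :
    toricChart hS τ B (S.toricMk τ φ) = B.coords φ := by
  have h := ((hS.isOpenEmbedding_toricMk τ).comp
      B.coordHomeomorph.isOpenEmbedding).toOpenPartialHomeomorph_left_inv
      (x := B.coordHomeomorph.symm φ)
  rw [Function.comp_apply, Homeomorph.apply_symm_apply] at h
  have h1 : toricChart hS τ B (S.toricMk τ φ) = (((((hS.isOpenEmbedding_toricMk τ).comp
      B.coordHomeomorph.isOpenEmbedding).toOpenPartialHomeomorph _).symm (S.toricMk τ φ)).1) := by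
    simp only [toricChart, OpenPartialHomeomorph.trans_apply]
    rfl
  rw [h1, h]
  rfl

theorem toricChart_symm_coords (φ : AffineToric τ.1) :
    (toricChart hS τ B).symm (B.coords φ) = S.toricMk τ φ := by
  rw [← toricChart_toricMk hS B φ]
  exact (toricChart hS τ B).left_inv (toricMk_mem_source hS B φ)

/-- The sign condition on exponents is what makes these monomial transition functions analytic. -/
theorem toricChart_eq_monomial {x : S.ToricVariety} (hx : x ∈ (toricChart hS τ B).source)
    (hx' : x ∈ (toricChart hS σ B').source) (i : Fin (n + 1)) :
    (∀ j, toricChart hS τ B x j = 0 → 0 ≤ B'.dual i ⬝ᵥ B.gen j) ∧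
      toricChart hS σ B' x i = B.monomial (toricChart hS τ B x) (B'.dual i) := by
  rw [toricChart_source] at hx hx'
  obtain ⟨φ, rfl⟩ := hx
  obtain ⟨ψ, hψ⟩ := hx'
  obtain ⟨h1, h2⟩ := hS.of_toricMk_eq B hψ.symm
  rw [toricChart_toricMk, ← hψ, toricChart_toricMk]
  exact ⟨fun j hj => B.dot_nonneg_of_mem (B'.dual_mem i) (h1 j hj), h2 _⟩

theorem contDiffOn_toricChart_transition :
    ContDiffOn ℂ ω ((toricChart hS τ B).symm.trans (toricChart hS σ B'))
      ((toricChart hS τ B).symm.trans (toricChart hS σ B')).source := by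
  intro z hz
  set e := toricChart hS τ B
  set e' := toricChart hS σ B'
  have hopen := (e.symm.trans e').open_source
  have hx : ∀ w ∈ (e.symm.trans e').source, e.symm w ∈ e.source ∧ e.symm w ∈ e'.source ∧
      e (e.symm w) = w := by
    intro w hw
    rw [OpenPartialHomeomorph.trans_source, OpenPartialHomeomorph.symm_source] at hw
    exact ⟨e.map_target hw.1, hw.2, e.right_inv hw.1⟩
  have han : AnalyticAt ℂ (fun w : Fin (n + 1) → ℂ => fun i => B.monomial w (B'.dual i)) z := by
    rw [analyticAt_pi_iff]
    intro i
    obtain ⟨h1, h2, h3⟩ := hx z hz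
    have := (toricChart_eq_monomial hS B B' h1 h2 i).1
    rw [h3] at this
    exact B.analyticAt_monomial this
  refine (han.contDiffAt.congr_of_eventuallyEq ?_).contDiffWithinAt
  filter_upwards [hopen.mem_nhds hz] with w hw
  funext i
  obtain ⟨h1, h2, h3⟩ := hx w hw
  have := (toricChart_eq_monomial hS B B' h1 h2 i).2
  rw [h3] at this
  exact this

theorem toricConj_mem_source {x : S.ToricVariety} (hx : x ∈ (toricChart hS τ B).source) :
    S.toricConj x ∈ (toricChart hS τ B).source := by
  rw [toricChart_source] at hx ⊢
  obtain ⟨φ, rfl⟩ := hx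
  exact ⟨_, rfl⟩

theorem toricChart_toricConj {x : S.ToricVariety} (hx : x ∈ (toricChart hS τ B).source)
    (i : Fin (n + 1)) : toricChart hS τ B (S.toricConj x) i = conj (toricChart hS τ B x i) := by
  rw [toricChart_source] at hx
  obtain ⟨φ, rfl⟩ := hx
  rw [toricConj_toricMk, toricChart_toricMk, toricChart_toricMk]
  rfl

theorem toricProj_eq_prod {x : S.ToricVariety} (hx : x ∈ (toricChart hS τ B).source) :
    S.toricProj x = ∏ i, toricChart hS τ B x i ^ B.gen i (Fin.last n) := by
  rw [toricChart_source] at hx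
  obtain ⟨φ, rfl⟩ := hx
  rw [toricProj_toricMk, B.apply_eq_monomial, toricChart_toricMk, ConeBasis.monomial]
  refine Finset.prod_congr rfl fun i _ => ?_
  rw [lastForm, single_one_dotProduct]

theorem mem_supp_of_toricChart_eq_zero {x : S.ToricVariety}
    (hx : x ∈ (toricChart hS τ B).source) {i : Fin (n + 1)} (hi : toricChart hS τ B x i = 0) :
    i ∈ B.supp := by
  rw [toricChart_source] at hx
  obtain ⟨φ, rfl⟩ := hx
  rw [toricChart_toricMk] at hi
  exact B.mem_supp_of_coords_eq_zero hi

end Chart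

/-- The atlas of the toric variety given by monomial coordinates. -/
abbrev toricChartedSpace (hS : S.IsUnimodular) (B : ∀ τ : S.fan, ConeBasis τ.1) :
    ChartedSpace (Fin (n + 1) → ℂ) S.ToricVariety where
  atlas := Set.range fun τ => toricChart hS τ (B τ)
  chartAt x := toricChart hS (exists_toricMk x).choose (B _)
  mem_chart_source x := by
    rw [toricChart_source]
    exact (exists_toricMk x).choose_spec
  chart_mem_atlas x := ⟨_, rfl⟩

section Manifold

variable (hS : S.IsUnimodular) (B : ∀ τ : S.fan, ConeBasis τ.1)

theorem isManifold_toric :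
    letI := toricChartedSpace hS B
    IsManifold 𝓘(ℂ, Fin (n + 1) → ℂ) ω S.ToricVariety := by
  let _ := toricChartedSpace hS B
  refine isManifold_of_contDiffOn _ _ _ ?_
  rintro _ _ ⟨τ, rfl⟩ ⟨σ, rfl⟩
  simpa using contDiffOn_toricChart_transition hS (B τ) (B σ)

theorem toricChart_mem_maximalAtlas (τ : S.fan) :
    letI := toricChartedSpace hS B
    toricChart hS τ (B τ) ∈
      IsManifold.maximalAtlas 𝓘(ℂ, Fin (n + 1) → ℂ) ω S.ToricVariety := by
  let _ := toricChartedSpace hS B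
  let _ := isManifold_toric hS B
  exact IsManifold.subset_maximalAtlas ⟨τ, rfl⟩

theorem contMDiffAt_toric_iff (f : S.ToricVariety → ℂ) (x : S.ToricVariety) :
    letI := toricChartedSpace hS B
    ContMDiffAt 𝓘(ℂ, Fin (n + 1) → ℂ) 𝓘(ℂ, ℂ) ω f x ↔ S.IsToricHolomorphicAt f x := by
  let _ := toricChartedSpace hS B
  let _ := isManifold_toric hS B
  constructor
  · intro hf
    obtain ⟨τ, φ, rfl⟩ := exists_toricMk x
    have he := toricChart_mem_maximalAtlas hS B τ
    set e := toricChart hS τ (B τ) with he'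
    have hsrc := toricMk_mem_source hS (B τ) φ
    have hφ := toricChart_toricMk hS (B τ) φ
    -- The dual basis monomials are the chart coordinates themselves, so `F` is `f` read in the
    -- chart.
    refine ⟨τ, φ, n + 1, fun i => ⟨(B τ).dual i, (B τ).dual_mem i⟩, f ∘ e.symm, rfl, ?_, ?_⟩
    · change AnalyticAt ℂ (f ∘ e.symm) ((B τ).coords φ)
      rw [← analyticWithinAt_univ, ← contDiffWithinAt_omega_iff_analyticWithinAt,
        contDiffWithinAt_univ, ← contMDiffAt_iff_contDiffAt]
      refine ContMDiffAt.comp _ (I' := 𝓘(ℂ, Fin (n + 1) → ℂ)) ?_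
        (contMDiffAt_symm_of_mem_maximalAtlas he ?_)
      · rwa [toricChart_symm_coords]
      · rw [← hφ]
        exact e.map_source hsrc
    · refine Filter.Eventually.of_forall fun ψ => ?_
      change _ = f (e.symm ((B τ).coords ψ))
      rw [toricChart_symm_coords]
  · rintro ⟨τ, φ, r, m, F, rfl, hF, hf⟩
    have he := toricChart_mem_maximalAtlas hS B τ
    set e := toricChart hS τ (B τ) with he'
    have hsrc := toricMk_mem_source hS (B τ) φ
    have hmono : ∀ ψ : AffineToric τ.1, ∀ j,
        (B τ).monomial (e (S.toricMk τ ψ)) (m j).1 = ψ.1 (m j) := fun ψ j => by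
      rw [he', toricChart_toricMk, (B τ).apply_eq_monomial]
    have h1 : AnalyticAt ℂ (fun z : Fin (n + 1) → ℂ => F fun j => (B τ).monomial z (m j).1)
        (e (S.toricMk τ φ)) := by
      refine AnalyticAt.fun_comp (g := F) (f := fun z j => (B τ).monomial z (m j).1) ?_ ?_
      · simpa only [hmono] using hF
      · rw [analyticAt_pi_iff]
        intro j
        refine (B τ).analyticAt_monomial fun i hi => ?_
        exact ((B τ).mem_dualSemigroup_iff _).1 (m j).2 i
          (mem_supp_of_toricChart_eq_zero hS (B τ) hsrc hi)
    have h2 : ContMDiffAt 𝓘(ℂ, Fin (n + 1) → ℂ) 𝓘(ℂ, ℂ) ω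
        ((fun z : Fin (n + 1) → ℂ => F fun j => (B τ).monomial z (m j).1) ∘ e)
        (S.toricMk τ φ) :=
      ContMDiffAt.comp _ h1.contDiffAt.contMDiffAt (contMDiffAt_of_mem_maximalAtlas he hsrc)
    refine h2.congr_of_eventuallyEq ?_
    rw [Filter.EventuallyEq, ← (hS.isOpenEmbedding_toricMk τ).map_nhds_eq, Filter.eventually_map]
    filter_upwards [hf] with ψ hψ
    simp only [Function.comp_apply, hmono]
    exact hψ

theorem contMDiff_toricProj :
    letI := toricChartedSpace hS B
    ContMDiff 𝓘(ℂ, Fin (n + 1) → ℂ) 𝓘(ℂ, ℂ) ω S.toricProj := by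
  let _ := toricChartedSpace hS B
  intro x
  rw [contMDiffAt_toric_iff hS B]
  obtain ⟨τ, φ, rfl⟩ := exists_toricMk x
  exact ⟨τ, φ, 1, fun _ => S.lastForm τ, fun z => z 0, rfl,
    (ContinuousLinearMap.proj (R := ℂ) (φ := fun _ : Fin 1 => ℂ) 0).analyticAt _,
    Filter.Eventually.of_forall fun ψ => rfl⟩

theorem _root_.ConeBasis.exists_gen_apply_ne_zero {N : ℕ} {τ : Set (Fin N → ℝ)} (B : ConeBasis τ)
    (j : Fin N) : ∃ i, B.gen i j ≠ 0 := by
  by_contra! h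
  have h1 := congrFun (B.expand (Pi.single j 1)) j
  simp [h] at h1

/-- No factor of the monomial vanishes, so varying a coordinate with nonzero exponent `a` gives a
function `t ^ a * c` with `c ≠ 0`, whose derivative is nonzero at the point. -/
theorem surjective_mfderiv_toricProj {x : S.ToricVariety} (hx : S.toricProj x ≠ 0) :
    letI := toricChartedSpace hS B
    Function.Surjective (mfderiv 𝓘(ℂ, Fin (n + 1) → ℂ) 𝓘(ℂ, ℂ) S.toricProj x) := by
  let _ := toricChartedSpace hS B
  let _ := isManifold_toric hS B
  obtain ⟨τ, φ, rfl⟩ := exists_toricMk x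
  have he := toricChart_mem_maximalAtlas hS B τ
  have hsrc := toricMk_mem_source hS (B τ) φ
  set e := toricChart hS τ (B τ) with he'
  set x := S.toricMk τ φ
  obtain ⟨i, hi⟩ := (B τ).exists_gen_apply_ne_zero (Fin.last n)
  have hprod := toricProj_eq_prod hS (B τ) hsrc
  rw [← he'] at hprod
  have hfac : ∀ j, e x j ^ (B τ).gen j (Fin.last n) ≠ 0 := by
    rw [hprod, Finset.prod_ne_zero_iff] at hx
    exact fun j => hx j (Finset.mem_univ j)
  have hzi : e x i ≠ 0 := by
    intro h
    have := hfac i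
    rw [h, zero_zpow _ hi] at this
    exact this rfl
  let g : ℂ → Fin (n + 1) → ℂ := fun t => Function.update (e x) i t
  have hg0 : g (e x i) = e x := Function.update_eq_self i (e x)
  have hg : ContDiff ℂ ω g := by
    rw [contDiff_pi]
    intro j
    by_cases hj : j = i
    · subst hj
      simp only [g, Function.update_self]
      exact contDiff_id
    · simp only [g, Function.update_of_ne hj]
      exact contDiff_const
  have hcurve : e.symm (g (e x i)) = x := by rw [hg0, e.left_inv hsrc]
  have htgt : g (e x i) ∈ e.target := by rw [hg0]; exact e.map_source hsrc
  have hmd : MDifferentiableAt 𝓘(ℂ, ℂ) 𝓘(ℂ, Fin (n + 1) → ℂ) (e.symm ∘ g) (e x i) := by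
    have h1 : ContMDiffAt 𝓘(ℂ, ℂ) 𝓘(ℂ, Fin (n + 1) → ℂ) ω (e.symm ∘ g) (e x i) :=
      ContMDiffAt.comp _ (contMDiffAt_symm_of_mem_maximalAtlas he htgt)
        hg.contDiffAt.contMDiffAt
    exact h1.mdifferentiableAt (by simp)
  set c := ∏ j ∈ Finset.univ.erase i, e x j ^ (B τ).gen j (Fin.last n)
  have hev : (S.toricProj ∘ e.symm ∘ g) =ᶠ[nhds (e x i)]
      fun t => t ^ (B τ).gen i (Fin.last n) * c := by
    filter_upwards [hg.continuous.continuousAt.preimage_mem_nhds (e.open_target.mem_nhds htgt)]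
      with t ht
    have h1 := toricProj_eq_prod hS (B τ) (e.map_target ht)
    rw [← he', e.right_inv ht, ← Finset.mul_prod_erase _ _ (Finset.mem_univ i)] at h1
    simp only [Function.comp_apply]
    rw [h1]
    congr 1
    · simp [g]
    · refine Finset.prod_congr rfl fun j hj => ?_
      simp [g, Finset.ne_of_mem_erase hj]
  have hder : HasDerivAt (S.toricProj ∘ e.symm ∘ g)
      (((B τ).gen i (Fin.last n) : ℂ) * e x i ^ ((B τ).gen i (Fin.last n) - 1) * c) (e x i) :=
    ((hasDerivAt_zpow _ _ (Or.inl hzi)).mul_const c).congr_of_eventuallyEq hev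
  have hne : ((B τ).gen i (Fin.last n) : ℂ) * e x i ^ ((B τ).gen i (Fin.last n) - 1) * c ≠ 0 :=
    mul_ne_zero (mul_ne_zero (by exact_mod_cast hi) (zpow_ne_zero _ hzi))
      (Finset.prod_ne_zero_iff.2 fun j _ => hfac j)
  have hπ := (contMDiff_toricProj hS B).mdifferentiable (by simp) ((e.symm ∘ g) (e x i))
  have key := surjective_mfderiv_of_curve hπ hmd hne hder
  rw [Function.comp_apply, hcurve] at key
  exact key

theorem isAntiholomorphic_toricConj :
    letI := toricChartedSpace hS B
    IsAntiholomorphic (n + 1) S.toricConj := by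
  let _ := toricChartedSpace hS B
  let _ := isManifold_toric hS B
  refine ⟨continuous_toricConj, fun p => ?_⟩
  -- The chart domain is stable under conjugation, so the conjugated coordinates of the image are
  -- the coordinates of the point itself.
  obtain ⟨τ, hτ⟩ : ∃ τ, chartAt (Fin (n + 1) → ℂ) (S.toricConj p) = toricChart hS τ (B τ) :=
    ⟨_, rfl⟩
  have hp : p ∈ (toricChart hS τ (B τ)).source := by
    have := toricConj_mem_source hS (B τ)
      (hτ ▸ mem_chart_source (Fin (n + 1) → ℂ) (S.toricConj p))
    rwa [involutive_toricConj] at this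
  rw [hτ]
  refine (contMDiffAt_of_mem_maximalAtlas (toricChart_mem_maximalAtlas hS B τ)
    hp).congr_of_eventuallyEq ?_
  filter_upwards [(toricChart hS τ (B τ)).open_source.mem_nhds hp] with x hx
  funext i
  rw [toricChart_toricConj hS (B τ) hx, Complex.conj_conj]

end Manifold

end PolyhedralSubdivision

/-! # Normal crossing charts -/

section NormalForm

variable {d : ℕ}

theorem exists_perm_lt_card (J : Finset (Fin d)) :
    ∃ s : Equiv.Perm (Fin d), ∀ i, i ∈ J ↔ (s i).val < J.card := by
  have hle : J.card ≤ d := by simpa using J.card_le_univ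
  have hcard : Fintype.card {i // i ∈ J} = Fintype.card {i : Fin d // i.val < J.card} := by
    rw [Fintype.card_coe, Fintype.card_subtype, Fin.card_filter_val_lt, min_eq_right hle]
  let e := Fintype.equivOfCardEq hcard
  exact ⟨e.extendSubtype, fun i => ⟨e.extendSubtype_mem i, fun h => by
    by_contra hi
    exact e.extendSubtype_not_mem i hi h⟩⟩

variable (z₀ : Fin d → ℂ) (c : Fin d → ℤ)

/-- The product of the Laurent monomials in the coordinates that do not vanish at `z₀`. -/
def unitPart (z : Fin d → ℂ) : ℂ := ∏ i with z₀ i ≠ 0, z i ^ c i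

theorem unitPart_update {j : Fin d} (hj : z₀ j = 0) (z : Fin d → ℂ) (a : ℂ) :
    unitPart z₀ c (Function.update z j a) = unitPart z₀ c z := by
  refine Finset.prod_congr rfl fun i hi => ?_
  rw [Function.update_of_ne]
  rintro rfl
  exact (Finset.mem_filter.1 hi).2 hj

theorem unitPart_ne_zero {z : Fin d → ℂ} (hz : ∀ i, z₀ i ≠ 0 → z i ≠ 0) :
    unitPart z₀ c z ≠ 0 :=
  Finset.prod_ne_zero_iff.2 fun i hi => zpow_ne_zero _ (hz i (Finset.mem_filter.1 hi).2)

theorem analyticAt_unitPart {z : Fin d → ℂ} (hz : ∀ i, z₀ i ≠ 0 → z i ≠ 0) :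
    AnalyticAt ℂ (unitPart z₀ c) z := by
  unfold unitPart
  refine Finset.analyticAt_fun_prod _ fun i hi => ?_
  exact ((ContinuousLinearMap.proj (R := ℂ) (φ := fun _ : Fin d => ℂ) i).analyticAt z).fun_zpow
    (hz i (Finset.mem_filter.1 hi).2)

theorem contDiffOn_update {j : Fin d} {f : (Fin d → ℂ) → ℂ} {s : Set (Fin d → ℂ)}
    (hf : ∀ z ∈ s, AnalyticAt ℂ f z) :
    ContDiffOn ℂ ω (fun z => Function.update z j (f z)) s := by
  rw [contDiffOn_pi]
  intro i
  by_cases hi : i = j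
  · subst hi
    simp only [Function.update_self]
    exact fun z hz => (hf z hz).contDiffAt.contDiffWithinAt
  · simp only [Function.update_of_ne hi]
    exact (contDiff_apply ℂ ℂ i).contDiffOn

/-- Multiplication of the `j`-th coordinate by the unit part. -/
def absorbUnit {j : Fin d} (hj : z₀ j = 0) : OpenPartialHomeomorph (Fin d → ℂ) (Fin d → ℂ) where
  toFun z := Function.update z j (z j * unitPart z₀ c z)
  invFun z := Function.update z j (z j / unitPart z₀ c z)
  source := {z | ∀ i, z₀ i ≠ 0 → z i ≠ 0}
  target := {z | ∀ i, z₀ i ≠ 0 → z i ≠ 0}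
  map_source' z hz i hi := by
    rw [Function.update_of_ne (by rintro rfl; exact hi hj)]
    exact hz i hi
  map_target' z hz i hi := by
    rw [Function.update_of_ne (by rintro rfl; exact hi hj)]
    exact hz i hi
  -- The unit part does not involve the `j`-th coordinate, so dividing by it undoes the
  -- multiplication.
  left_inv' z hz := by
    rw [unitPart_update z₀ c hj, Function.update_self,
      mul_div_cancel_right₀ _ (unitPart_ne_zero z₀ c hz), Function.update_idem,
      Function.update_eq_self]
  right_inv' z hz := by
    rw [unitPart_update z₀ c hj, Function.update_self,
      div_mul_cancel₀ _ (unitPart_ne_zero z₀ c hz), Function.update_idem,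
      Function.update_eq_self]
  open_source := by
    simp only [Set.ofPred_forall]
    exact isOpen_iInter_of_finite fun i => isOpen_iInter_of_finite fun _ =>
      isOpen_ne.preimage (continuous_apply i)
  open_target := by
    simp only [Set.ofPred_forall]
    exact isOpen_iInter_of_finite fun i => isOpen_iInter_of_finite fun _ =>
      isOpen_ne.preimage (continuous_apply i)
  continuousOn_toFun := (contDiffOn_update fun z hz =>
    ((ContinuousLinearMap.proj (R := ℂ) (φ := fun _ : Fin d => ℂ) j).analyticAt z).fun_mul
      (analyticAt_unitPart z₀ c hz)).continuousOn
  continuousOn_invFun := (contDiffOn_update fun z hz =>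
    ((ContinuousLinearMap.proj (R := ℂ) (φ := fun _ : Fin d => ℂ) j).analyticAt z).fun_div
      (analyticAt_unitPart z₀ c hz) (unitPart_ne_zero z₀ c hz)).continuousOn

/-- Translation by `-z₀` followed by a permutation of the coordinates. -/
def translatePermute (s : Equiv.Perm (Fin d)) : (Fin d → ℂ) ≃ₜ (Fin d → ℂ) where
  toFun z := fun i => z (s.symm i) - z₀ (s.symm i)
  invFun z := fun i => z (s i) + z₀ i
  left_inv z := by
    funext i
    simp
  right_inv z := by
    funext i
    simp
  continuous_toFun := by fun_prop
  continuous_invFun := by fun_prop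

/-- The coordinate change that brings a monomial function into normal crossing form. -/
def normalFormChange {j : Fin d} (hj : z₀ j = 0) (s : Equiv.Perm (Fin d)) :
    OpenPartialHomeomorph (Fin d → ℂ) (Fin d → ℂ) :=
  (absorbUnit z₀ c hj).transHomeomorph (translatePermute z₀ s)

theorem normalFormChange_apply {j : Fin d} (hj : z₀ j = 0) (s : Equiv.Perm (Fin d))
    (z : Fin d → ℂ) (i : Fin d) : normalFormChange z₀ c hj s z i
      = Function.update z j (z j * unitPart z₀ c z) (s.symm i) - z₀ (s.symm i) := rfl

theorem normalFormChange_symm_apply {j : Fin d} (hj : z₀ j = 0) (s : Equiv.Perm (Fin d)) :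
    ⇑(normalFormChange z₀ c hj s).symm = (absorbUnit z₀ c hj).symm ∘ (translatePermute z₀ s).symm :=
  rfl

theorem contDiffOn_normalFormChange {j : Fin d} (hj : z₀ j = 0) (s : Equiv.Perm (Fin d)) :
    ContDiffOn ℂ ω (normalFormChange z₀ c hj s) (normalFormChange z₀ c hj s).source := by
  have h1 : ContDiffOn ℂ ω (absorbUnit z₀ c hj) (absorbUnit z₀ c hj).source :=
    contDiffOn_update fun z hz =>
      ((ContinuousLinearMap.proj (R := ℂ) (φ := fun _ : Fin d => ℂ) j).analyticAt z).fun_mul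
        (analyticAt_unitPart z₀ c hz)
  have h2 : ContDiff ℂ ω (translatePermute z₀ s) :=
    contDiff_pi.2 fun i => (contDiff_apply ℂ ℂ _).sub contDiff_const
  exact h2.comp_contDiffOn h1

theorem contDiffOn_normalFormChange_symm {j : Fin d} (hj : z₀ j = 0) (s : Equiv.Perm (Fin d)) :
    ContDiffOn ℂ ω (normalFormChange z₀ c hj s).symm (normalFormChange z₀ c hj s).target := by
  have h1 : ContDiffOn ℂ ω (absorbUnit z₀ c hj).symm (absorbUnit z₀ c hj).target :=
    contDiffOn_update fun z hz =>
      ((ContinuousLinearMap.proj (R := ℂ) (φ := fun _ : Fin d => ℂ) j).analyticAt z).fun_div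
        (analyticAt_unitPart z₀ c hz) (unitPart_ne_zero z₀ c hz)
  have h2 : ContDiff ℂ ω (translatePermute z₀ s).symm :=
    contDiff_pi.2 fun i => (contDiff_apply ℂ ℂ _).add contDiff_const
  rw [normalFormChange_symm_apply]
  exact h1.comp h2.contDiffOn fun z hz => hz

theorem normalFormChange_self {j : Fin d} (hj : z₀ j = 0) (s : Equiv.Perm (Fin d)) :
    normalFormChange z₀ c hj s z₀ = 0 := by
  funext i
  rw [normalFormChange_apply, hj, zero_mul, Pi.zero_apply, sub_eq_zero]
  conv_rhs => rw [← Function.update_eq_self j z₀, hj]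

/-- Integral exponents and a real centre make the coordinate change commute with conjugation. -/
theorem normalFormChange_conj {j : Fin d} (hj : z₀ j = 0) (s : Equiv.Perm (Fin d))
    (hz₀ : ∀ i, conj (z₀ i) = z₀ i) {z w : Fin d → ℂ} (h : ∀ i, w i = conj (z i)) (i : Fin d) :
    normalFormChange z₀ c hj s w i = conj (normalFormChange z₀ c hj s z i) := by
  have hu : unitPart z₀ c w = conj (unitPart z₀ c z) := by
    simp only [unitPart, map_prod, map_zpow₀, h]
  rw [normalFormChange_apply, normalFormChange_apply, map_sub, hz₀]
  congr 1
  by_cases hi : s.symm i = j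
  · rw [hi, Function.update_self, Function.update_self, map_mul, hu, h]
  · rw [Function.update_of_ne hi, Function.update_of_ne hi, h]

/-- Factors nonvanishing at `z₀` are collected in the unit, which the `j`-th coordinate carries;
vanishing ones have exponent `0` or `1`, and `s` moves those with exponent `1` to the front. -/
theorem prod_zpow_eq_prod_normalFormChange (hc : ∀ i, z₀ i = 0 → c i = 0 ∨ c i = 1) {j : Fin d}
    (hj : z₀ j = 0) (hcj : c j = 1) {s : Equiv.Perm (Fin d)} {k : ℕ}
    (hs : ∀ i, (z₀ i = 0 ∧ c i = 1) ↔ (s i).val < k) (z : Fin d → ℂ) :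
    ∏ i, z i ^ c i = ∏ i : Fin d with i.val < k, normalFormChange z₀ c hj s z i := by
  have h1 : ∏ i : Fin d with i.val < k, normalFormChange z₀ c hj s z i
      = ∏ i with z₀ i = 0 ∧ c i = 1, Function.update z j (z j * unitPart z₀ c z) i := by
    symm
    refine Finset.prod_equiv s ?_ ?_
    · intro i
      simp [hs]
    · intro i hi
      rw [normalFormChange_apply, s.symm_apply_apply, (Finset.mem_filter.1 hi).2.1, sub_zero]
  have hjm : j ∈ Finset.univ.filter fun i => z₀ i = 0 ∧ c i = 1 := by simp [hj, hcj]
  have h2 : ∏ i with z₀ i = 0 ∧ c i = 1, Function.update z j (z j * unitPart z₀ c z) i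
      = unitPart z₀ c z * ∏ i with z₀ i = 0 ∧ c i = 1, z i := by
    rw [← Finset.mul_prod_erase _ _ hjm, ← Finset.mul_prod_erase _ (fun i => z i) hjm,
      Function.update_self]
    rw [Finset.prod_congr rfl fun i hi =>
      Function.update_of_ne (Finset.ne_of_mem_erase hi) _ _]
    ring
  have h3 : ∏ i with z₀ i = 0 ∧ c i = 1, z i = ∏ i with z₀ i = 0, z i ^ c i := by
    rw [← Finset.filter_filter, Finset.prod_filter]
    refine Finset.prod_congr rfl fun i hi => ?_
    rcases hc i (Finset.mem_filter.1 hi).2 with h | h <;> simp [h]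
  rw [h1, h2, h3, unitPart, mul_comm]
  exact (Finset.prod_filter_mul_prod_filter_not _ _ _).symm

end NormalForm

section Charts

variable {d : ℕ} {X : Type*} [TopologicalSpace X] [ChartedSpace (Fin d → ℂ) X]

/-- `e` is a normal crossing chart at `p`, and it is real for `ι` if `ι` fixes `p`. -/
structure IsRealNormalCrossingChart (π : X → ℂ) (ι : X → X) (p : X) (k : ℕ)
    (e : OpenPartialHomeomorph X (Fin d → ℂ)) : Prop extends IsNormalCrossingChart π p k e where
  conj_eq : ι p = p → ∀ᶠ x in nhds p, ∀ i, e (ι x) i = conj (e x i)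

/-- A function that is a monomial with exponents `0` and `1` in the coordinates vanishing at `p` has
normal crossings at `p`. -/
theorem exists_isRealNormalCrossingChart [IsManifold 𝓘(ℂ, Fin d → ℂ) ω X] {π : X → ℂ} {ι : X → X}
    {p : X} {e : OpenPartialHomeomorph X (Fin d → ℂ)}
    (he : e ∈ IsManifold.maximalAtlas 𝓘(ℂ, Fin d → ℂ) ω X) (hp : p ∈ e.source) {c : Fin d → ℤ}
    (hc : ∀ i, e p i = 0 → c i = 0 ∨ c i = 1) (hπ : ∀ x ∈ e.source, π x = ∏ i, e x i ^ c i)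
    (hι : ∀ x ∈ e.source, ∀ i, e (ι x) i = conj (e x i)) (hp0 : π p = 0) :
    ∃ (k : ℕ) (e' : OpenPartialHomeomorph X (Fin d → ℂ)),
      IsRealNormalCrossingChart π ι p k e' := by
  classical
  obtain ⟨j, hj, hcj⟩ : ∃ j, e p j = 0 ∧ c j = 1 := by
    rw [hπ p hp, Finset.prod_eq_zero_iff] at hp0
    obtain ⟨j, -, hj⟩ := hp0
    have hj0 : e p j = 0 := by
      by_contra h
      exact zpow_ne_zero _ h hj
    refine ⟨j, hj0, (hc j hj0).resolve_left fun h => ?_⟩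
    rw [h, zpow_zero] at hj
    exact one_ne_zero hj
  let J : Finset (Fin d) := Finset.univ.filter fun i => e p i = 0 ∧ c i = 1
  obtain ⟨s, hs⟩ := exists_perm_lt_card J
  let Ψ := normalFormChange (e p) c hj s
  refine ⟨J.card, e.trans Ψ, ⟨?_, ?_, ?_, ?_, ?_, ?_⟩, ?_⟩
  · refine OpenPartialHomeomorph.mem_maximalAtlas_of_contMDiffOn _ ?_ ?_
    · rw [OpenPartialHomeomorph.coe_trans, OpenPartialHomeomorph.trans_source]
      exact (contDiffOn_normalFormChange (e p) c hj s).contMDiffOn.comp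
        ((contMDiffOn_of_mem_maximalAtlas he).mono Set.inter_subset_left) fun x hx => hx.2
    · rw [OpenPartialHomeomorph.coe_trans_symm, OpenPartialHomeomorph.trans_target]
      exact (contMDiffOn_symm_of_mem_maximalAtlas he).comp
        ((contDiffOn_normalFormChange_symm (e p) c hj s).contMDiffOn.mono Set.inter_subset_left)
        fun x hx => hx.2
  · rw [OpenPartialHomeomorph.trans_source]
    exact ⟨hp, fun i hi => hi⟩
  · exact normalFormChange_self (e p) c hj s
  · exact Finset.card_pos.2 ⟨j, by simp [J, hj, hcj]⟩
  · simpa using J.card_le_univ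
  · intro x hx
    rw [OpenPartialHomeomorph.trans_source] at hx
    rw [hπ x hx.1]
    refine prod_zpow_eq_prod_normalFormChange (e p) c hc hj hcj (fun i => ?_) (e x)
    rw [← hs i]
    simp [J]
  · intro hp'
    have hreal : ∀ i, conj (e p i) = e p i := by
      intro i
      rw [← hι p hp i, hp']
    filter_upwards [e.open_source.mem_nhds hp] with x hx
    exact normalFormChange_conj (e p) c hj s hreal (hι x hx)

end Charts

namespace PolyhedralSubdivision

variable {n : ℕ} {S : PolyhedralSubdivision n}

theorem IsStronglyUnimodular.exists_isRealNormalCrossingChart (hS : S.IsStronglyUnimodular)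
    (B : ∀ τ : S.fan, ConeBasis τ.1) {p : S.ToricVariety} (hp : S.toricProj p = 0) :
    letI := toricChartedSpace hS.1 B
    ∃ (k : ℕ) (e : OpenPartialHomeomorph S.ToricVariety (Fin (n + 1) → ℂ)),
      IsRealNormalCrossingChart S.toricProj S.toricConj p k e := by
  let _ := toricChartedSpace hS.1 B
  have := isManifold_toric hS.1 B
  obtain ⟨τ, φ, rfl⟩ := exists_toricMk p
  have hsrc := toricMk_mem_source hS.1 (B τ) φ
  exact _root_.exists_isRealNormalCrossingChart (toricChart_mem_maximalAtlas hS.1 B τ) hsrc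
    (fun i hi => hS.gen_last τ.2 (B τ) (mem_supp_of_toricChart_eq_zero hS.1 (B τ) hsrc hi))
    (fun x hx => toricProj_eq_prod hS.1 (B τ) hx)
    (fun x hx => toricChart_toricConj hS.1 (B τ) hx) hp

end PolyhedralSubdivision

/-! # The totally real condition -/

section TotallyReal

variable {d : ℕ} {X : Type*} [TopologicalSpace X] [ChartedSpace (Fin d → ℂ) X]

theorem HasMFDerivAt.real_of_complex {E F M M' : Type*} [NormedAddCommGroup E] [NormedSpace ℂ E]
    [NormedAddCommGroup F] [NormedSpace ℂ F] [TopologicalSpace M] [ChartedSpace E M]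
    [TopologicalSpace M'] [ChartedSpace F M'] {f : M → M'} {x : M} {f' : E →L[ℂ] F}
    (h : HasMFDerivAt 𝓘(ℂ, E) 𝓘(ℂ, F) f x f') :
    HasMFDerivAt 𝓘(ℝ, E) 𝓘(ℝ, F) f x (f'.restrictScalars ℝ) :=
  ⟨h.1, HasFDerivWithinAt.restrictScalars ℝ h.2⟩

/-- If the set where `z_i = 0` is mapped into a union of coordinate hyperplanes, its tangent space
is mapped into one of them. -/
theorem exists_coord_deriv_eq_zero {Φ : (Fin d → ℂ) → Fin d → ℂ}
    {Φ' : (Fin d → ℂ) →L[ℂ] Fin d → ℂ} (hΦ : HasFDerivAt Φ Φ' 0)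
    {i : Fin d} {k : ℕ} (h : ∀ᶠ z in nhds (0 : Fin d → ℂ), z i = 0 →
      ∃ j : Fin d, j.val < k ∧ Φ z j = 0) :
    ∃ j : Fin d, j.val < k ∧ ∀ v : Fin d → ℂ, v i = 0 → Φ' v j = 0 := by
  let H : Submodule ℂ (Fin d → ℂ) := LinearMap.ker (LinearMap.proj i)
  have hH : ∀ v : H, v.1 i = 0 := fun v => v.2
  let p : {j : Fin d // j.val < k} → Subspace ℂ H := fun j =>
    LinearMap.ker ((LinearMap.proj (φ := fun _ : Fin d => ℂ) j.1).comp (Φ'.toLinearMap.comp H.subtype))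
  -- On each line through `0` in the hyperplane, one coordinate of `Φ` vanishes at points
  -- accumulating at `0`, hence so does its derivative. Finitely many subspaces thus cover the
  -- hyperplane; over an infinite field one of them must be everything.
  have hcov : ⋃ j, (p j : Set H) = Set.univ := by
    refine Set.eq_univ_of_forall fun v => ?_
    have hlim : Filter.Tendsto (fun t : ℂ => t • v.1) (nhdsWithin 0 {0}ᶜ)
        (nhds (0 : Fin d → ℂ)) := by
      have : Continuous fun t : ℂ => t • v.1 := by fun_prop
      have h0 := this.tendsto 0
      rw [zero_smul] at h0
      exact h0.mono_left nhdsWithin_le_nhds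
    have h1 : ∀ᶠ t : ℂ in nhdsWithin 0 {0}ᶜ, ∃ j : Fin d, j.val < k ∧ Φ (t • v.1) j = 0 := by
      filter_upwards [hlim.eventually h] with t ht
      exact ht (by rw [Pi.smul_apply, hH, smul_zero])
    obtain ⟨j, hj, hfr⟩ : ∃ j : Fin d, j.val < k ∧
        ∃ᶠ t : ℂ in nhdsWithin 0 {0}ᶜ, Φ (t • v.1) j = 0 := by
      by_contra! hcon
      have h2 : ∀ᶠ t : ℂ in nhdsWithin 0 {0}ᶜ, ∀ j : Fin d, j.val < k → Φ (t • v.1) j ≠ 0 := by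
        rw [Filter.eventually_all]
        intro j
        by_cases hj : j.val < k
        · simpa [hj, Filter.Frequently] using hcon j hj
        · simp [hj]
      obtain ⟨t, ⟨j, hj, ht⟩, ht'⟩ := (h1.and h2).exists
      exact ht' j hj ht
    refine Set.mem_iUnion_of_mem ⟨j, hj⟩ ?_
    change Φ' v.1 j = 0
    by_contra hne
    have hder : HasDerivAt (fun t : ℂ => Φ (t • v.1) j) (Φ' v.1 j) 0 := by
      have h3 : HasDerivAt (fun t : ℂ => t • v.1) v.1 0 := by
        simpa using (hasDerivAt_id (0 : ℂ)).smul_const v.1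
      have h4 : HasDerivAt (fun t : ℂ => Φ (t • v.1)) (Φ' v.1) 0 := by
        refine HasFDerivAt.comp_hasDerivAt (f := fun t : ℂ => t • v.1) 0 ?_ h3
        rwa [zero_smul]
      exact hasDerivAt_pi.1 h4 j
    exact hfr (hder.eventually_ne hne)
  obtain ⟨⟨j, hj⟩, hp⟩ := Subspace.exists_eq_top_of_iUnion_eq_univ hcov
  refine ⟨j, hj, fun v hv => ?_⟩
  have : (⟨v, hv⟩ : H) ∈ p ⟨j, hj⟩ := by rw [hp]; trivial
  exact this

theorem ker_eq_of_ker_le {K V : Type*} [Field K] [AddCommGroup V] [Module K V] {a b : V →ₗ[K] K}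
    (h : ∀ v, a v = 0 → b v = 0) (hb : ∃ v, b v ≠ 0) (v : V) : a v = 0 ↔ b v = 0 := by
  refine ⟨h v, fun hv => ?_⟩
  obtain ⟨w, hw⟩ := hb
  have h1 := h (a w • v - a v • w) (by simp [mul_comm])
  rw [map_sub, map_smul, map_smul, hv, smul_zero, zero_sub, neg_eq_zero, smul_eq_mul] at h1
  exact (mul_eq_zero.1 h1).resolve_right hw

theorem OpenPartialHomeomorph.mdifferentiable_of_mem_maximalAtlas_omega
    {e : OpenPartialHomeomorph X (Fin d → ℂ)}
    (he : e ∈ IsManifold.maximalAtlas 𝓘(ℂ, Fin d → ℂ) ω X) :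
    e.MDifferentiable 𝓘(ℂ, Fin d → ℂ) 𝓘(ℂ, Fin d → ℂ) :=
  ⟨(contMDiffOn_of_mem_maximalAtlas he).mdifferentiableOn (by simp),
    (contMDiffOn_symm_of_mem_maximalAtlas he).mdifferentiableOn (by simp)⟩

/-- The hyperplanes of the tangent cone do not depend on the normal crossing chart. -/
theorem IsNormalCrossingChart.exists_same_hyperplane {π : X → ℂ} {p : X} {k k' : ℕ}
    {e e' : OpenPartialHomeomorph X (Fin d → ℂ)} (he : IsNormalCrossingChart π p k e)
    (he' : IsNormalCrossingChart π p k' e') {i : Fin d} (hi : i.val < k) :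
    ∃ j : Fin d, ∀ v : Fin d → ℂ,
      ((mfderiv 𝓘(ℂ, Fin d → ℂ) 𝓘(ℂ, Fin d → ℂ) e p : (Fin d → ℂ) →L[ℂ] (Fin d → ℂ)) v i = 0 ↔
        (mfderiv 𝓘(ℂ, Fin d → ℂ) 𝓘(ℂ, Fin d → ℂ) e' p : (Fin d → ℂ) →L[ℂ] (Fin d → ℂ)) v j
          = 0) := by
  have hd := e.mdifferentiable_of_mem_maximalAtlas_omega he.mem_maximalAtlas
  have hd' := e'.mdifferentiable_of_mem_maximalAtlas_omega he'.mem_maximalAtlas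
  have h0 : e.symm 0 = p := by rw [← he.centred, e.left_inv he.mem_source]
  have h0t : (0 : Fin d → ℂ) ∈ e.target := by
    rw [← he.centred]
    exact e.map_source he.mem_source
  set D : (Fin d → ℂ) →L[ℂ] (Fin d → ℂ) := mfderiv 𝓘(ℂ, Fin d → ℂ) 𝓘(ℂ, Fin d → ℂ) e p with hD
  set D' : (Fin d → ℂ) →L[ℂ] (Fin d → ℂ) := mfderiv 𝓘(ℂ, Fin d → ℂ) 𝓘(ℂ, Fin d → ℂ) e' p with hD'
  have hΦd : DifferentiableAt ℂ (e' ∘ e.symm) 0 := by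
    rw [← mdifferentiableAt_iff_differentiableAt]
    refine MDifferentiableAt.comp (I' := 𝓘(ℂ, Fin d → ℂ)) _ ?_ (hd.mdifferentiableAt_symm h0t)
    rw [h0]
    exact hd'.mdifferentiableAt he'.mem_source
  have hcomp : D' = (fderiv ℂ (e' ∘ e.symm) 0).comp D := by
    have h1 : HasMFDerivAt 𝓘(ℂ, Fin d → ℂ) 𝓘(ℂ, Fin d → ℂ) (e' ∘ e.symm) (e p)
        (fderiv ℂ (e' ∘ e.symm) 0) := by
      rw [he.centred]
      exact hΦd.hasFDerivAt.hasMFDerivAt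
    have h2 := h1.comp p (hd.mdifferentiableAt he.mem_source).hasMFDerivAt
    have h3 : (e' ∘ e.symm) ∘ e =ᶠ[nhds p] e' := by
      filter_upwards [e.open_source.mem_nhds he.mem_source] with x hx
      simp only [Function.comp_apply]
      rw [e.left_inv hx]
    exact (h2.congr_of_eventuallyEq h3.symm).mfderiv
  -- Points with `z i = 0` lie on the special fibre, so some factor of `π` in the other chart
  -- vanishes.
  have hzero : ∀ᶠ z in nhds (0 : Fin d → ℂ), z i = 0 →
      ∃ j : Fin d, j.val < k' ∧ (e' ∘ e.symm) z j = 0 := by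
    have hcont : ContinuousAt e.symm 0 := e.continuousAt_symm h0t
    have hs' : e'.source ∈ nhds (e.symm 0) := by
      rw [h0]
      exact e'.open_source.mem_nhds he'.mem_source
    filter_upwards [e.open_target.mem_nhds h0t, hcont.preimage_mem_nhds hs'] with z hz hz' hzi
    have h1 := he.eq_prod (e.symm z) (e.map_target hz)
    rw [e.right_inv hz, Finset.prod_eq_zero (i := i) (by simp [hi]) hzi,
      he'.eq_prod (e.symm z) hz', Finset.prod_eq_zero_iff] at h1
    obtain ⟨j, hj, hj0⟩ := h1
    exact ⟨j, (Finset.mem_filter.1 hj).2, hj0⟩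
  obtain ⟨j, -, hj⟩ := exists_coord_deriv_eq_zero hΦd.hasFDerivAt hzero
  refine ⟨j, ?_⟩
  have hsurj : Function.Surjective D' := hd'.mfderiv_surjective he'.mem_source
  have := ker_eq_of_ker_le (a := (LinearMap.proj (φ := fun _ : Fin d => ℂ) i).comp D.toLinearMap)
    (b := (LinearMap.proj (φ := fun _ : Fin d => ℂ) j).comp D'.toLinearMap)
    (fun v hv => by
      change D' v j = 0
      rw [hcomp]
      exact hj _ hv)
    (by
      obtain ⟨v, hv⟩ := hsurj (Pi.single j 1)
      refine ⟨v, ?_⟩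
      change D' v j ≠ 0
      rw [hv]
      simp)
  exact this

/-- A real normal crossing chart at each real point of the special fibre makes the real structure
totally real. -/
theorem IsRealNormalCrossingChart.image_coordHyperplane {π : X → ℂ} {ι : X → X} {p : X}
    {k k' : ℕ} {e e' : OpenPartialHomeomorph X (Fin d → ℂ)}
    (he' : IsRealNormalCrossingChart π ι p k' e') (he : IsNormalCrossingChart π p k e)
    (hι : Continuous ι) (hinv : Function.Involutive ι) (hp : ι p = p) {i : Fin d}
    (hi : i.val < k) :
    mfderiv 𝓘(ℝ, Fin d → ℂ) 𝓘(ℝ, Fin d → ℂ) ι p '' coordHyperplane e i p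
      = coordHyperplane e i (ι p) := by
  obtain ⟨j, hj⟩ := he.exists_same_hyperplane he'.toIsNormalCrossingChart hi
  have hd := e.mdifferentiable_of_mem_maximalAtlas_omega he.mem_maximalAtlas
  have hd' := e'.mdifferentiable_of_mem_maximalAtlas_omega he'.mem_maximalAtlas
  set D : (Fin d → ℂ) →L[ℂ] (Fin d → ℂ) := mfderiv 𝓘(ℂ, Fin d → ℂ) 𝓘(ℂ, Fin d → ℂ) e p
  set D' : (Fin d → ℂ) →L[ℂ] (Fin d → ℂ) := mfderiv 𝓘(ℂ, Fin d → ℂ) 𝓘(ℂ, Fin d → ℂ) e' p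
  have hDr : HasMFDerivAt 𝓘(ℝ, Fin d → ℂ) 𝓘(ℝ, Fin d → ℂ) e p (D.restrictScalars ℝ) :=
    HasMFDerivAt.real_of_complex (hd.mdifferentiableAt he.mem_source).hasMFDerivAt
  have hDr' : HasMFDerivAt 𝓘(ℝ, Fin d → ℂ) 𝓘(ℝ, Fin d → ℂ) e' p (D'.restrictScalars ℝ) :=
    HasMFDerivAt.real_of_complex (hd'.mdifferentiableAt he'.mem_source).hasMFDerivAt
  -- The point `q` is left variable because the target hyperplane lives at `ι p`, which equals `p`
  -- only propositionally.
  have hev : ∀ q, q = p → ∀ v : Fin d → ℂ, (mfderiv 𝓘(ℝ, Fin d → ℂ) 𝓘(ℝ, Fin d → ℂ) e q :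
      (Fin d → ℂ) →L[ℝ] (Fin d → ℂ)) v = D v := by
    rintro _ rfl v
    rw [hDr.mfderiv]
    rfl
  let cj : (Fin d → ℂ) →L[ℝ] (Fin d → ℂ) := ContinuousLinearMap.pi fun i =>
    Complex.conjCLE.toContinuousLinearMap.comp (ContinuousLinearMap.proj i)
  have hcj : ∀ v i, cj v i = conj (v i) := fun v i => rfl
  have h0 : e'.symm 0 = p := by rw [← he'.centred, e'.left_inv he'.mem_source]
  have h0t : (0 : Fin d → ℂ) ∈ e'.target := by
    rw [← he'.centred]
    exact e'.map_source he'.mem_source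
  have hιp : ∀ᶠ x in nhds p, ι x ∈ e'.source := by
    refine hι.continuousAt.preimage_mem_nhds ?_
    rw [hp]
    exact e'.open_source.mem_nhds he'.mem_source
  have hcjp : cj (e' p) = 0 := by
    rw [he'.centred, map_zero]
  -- Near `p`, `ι` is conjugation read through the real chart, hence real differentiable.
  obtain ⟨A, hA⟩ : ∃ A : (Fin d → ℂ) →L[ℝ] (Fin d → ℂ),
      HasMFDerivAt 𝓘(ℝ, Fin d → ℂ) 𝓘(ℝ, Fin d → ℂ) ι p A := by
    have h1 : HasMFDerivAt 𝓘(ℝ, Fin d → ℂ) 𝓘(ℝ, Fin d → ℂ) (cj ∘ e') p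
        (cj.comp (D'.restrictScalars ℝ)) :=
      cj.hasFDerivAt.hasMFDerivAt.comp p hDr'
    have h2 : MDifferentiableAt 𝓘(ℝ, Fin d → ℂ) 𝓘(ℝ, Fin d → ℂ) e'.symm ((cj ∘ e') p) := by
      rw [Function.comp_apply, hcjp]
      exact (HasMFDerivAt.real_of_complex
        (hd'.mdifferentiableAt_symm h0t).hasMFDerivAt).mdifferentiableAt
    refine ⟨_, (h2.hasMFDerivAt.comp p h1).congr_of_eventuallyEq ?_⟩
    filter_upwards [hιp, he'.conj_eq hp] with x hx hx'
    have : cj (e' x) = e' (ι x) := by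
      funext i
      rw [hcj, hx']
    simp only [Function.comp_apply]
    rw [this, e'.left_inv hx]
  -- This makes the image of the hyperplane all of it, not just a subset.
  have hAA : ∀ v : Fin d → ℂ, A (A v) = v := by
    have h1 : HasMFDerivAt 𝓘(ℝ, Fin d → ℂ) 𝓘(ℝ, Fin d → ℂ) ι (ι p) A := by rwa [hp]
    have h2 := h1.comp p hA
    rw [hinv.comp_self] at h2
    have h3 := hasMFDerivAt_unique h2 (hasMFDerivAt_id p)
    intro v
    exact congrArg (fun T : (Fin d → ℂ) →L[ℝ] (Fin d → ℂ) => T v) h3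
  have hconj : ∀ v : Fin d → ℂ, D' (A v) j = conj (D' v j) := by
    have h1 : HasMFDerivAt 𝓘(ℝ, Fin d → ℂ) 𝓘(ℝ, Fin d → ℂ) e' (ι p) (D'.restrictScalars ℝ) := by
      rwa [hp]
    have h2 := h1.comp p hA
    have h3 : HasMFDerivAt 𝓘(ℝ, Fin d → ℂ) 𝓘(ℝ, Fin d → ℂ) (cj ∘ e') p
        (cj.comp (D'.restrictScalars ℝ)) :=
      cj.hasFDerivAt.hasMFDerivAt.comp p hDr'
    have h4 : e' ∘ ι =ᶠ[nhds p] cj ∘ e' := by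
      filter_upwards [he'.conj_eq hp] with x hx
      funext i
      exact hx i
    have h5 := hasMFDerivAt_unique h2 (h3.congr_of_eventuallyEq h4)
    intro v
    exact congrArg (fun T : (Fin d → ℂ) →L[ℝ] (Fin d → ℂ) => T v j) h5
  have hmem : ∀ q, q = p → ∀ v : TangentSpace 𝓘(ℝ, Fin d → ℂ) q,
      (v ∈ coordHyperplane e i q ↔ D' v j = 0) := fun q hq v =>
    (Iff.of_eq (congrArg (fun u : Fin d → ℂ => u i = 0) (hev q hq v))).trans (hj v)
  have hker : ∀ v : Fin d → ℂ, D' v j = 0 → D' (A v) j = 0 := fun v hv => by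
    rw [hconj, hv, map_zero]
  rw [hA.mfderiv]
  ext w
  constructor
  · rintro ⟨v, hv, rfl⟩
    exact (hmem (ι p) hp (A v)).2 (hker v ((hmem p rfl v).1 hv))
  · intro hw
    exact ⟨A w, (hmem p rfl (A w)).2 (hker w ((hmem (ι p) hp w).1 hw)), hAA w⟩

end TotallyReal

/-! # Restriction of degenerations to smaller bases -/

section Restrict

open TopologicalSpace

variable {d : ℕ} {X : Type*} [TopologicalSpace X] [ChartedSpace (Fin d → ℂ) X]

theorem IsComplexManifold.opens (h : IsComplexManifold d X) (U : Opens X) :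
    IsComplexManifold d U := by
  obtain ⟨h1, h2, h3⟩ := h
  exact ⟨inferInstance, inferInstance, inferInstance⟩

theorem HasMFDerivAt.comp_opens_val {U : Opens X} {f : X → ℂ} {x : U} {f' : (Fin d → ℂ) →L[ℂ] ℂ}
    (h : HasMFDerivAt 𝓘(ℂ, Fin d → ℂ) 𝓘(ℂ, ℂ) f x.1 f') :
    HasMFDerivAt 𝓘(ℂ, Fin d → ℂ) 𝓘(ℂ, ℂ) (fun y : U => f y) x f' := by
  refine ⟨h.1.comp continuous_subtype_val.continuousAt, ?_⟩
  refine HasFDerivWithinAt.congr_of_eventuallyEq h.2 (nhdsWithin_le_nhds ?_) ?_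
  · filter_upwards [U.chartAt_subtype_val_symm_eventuallyEq (x := x) (H := Fin d → ℂ)] with z hz
    exact congrArg f hz.symm
  · exact congrArg f (U.chartAt_subtype_val_symm_eventuallyEq (x := x)
      (H := Fin d → ℂ)).self_of_nhds.symm

/-- Transitions between restricted charts are restrictions of transitions, and the smooth groupoid
is closed under restriction. -/
theorem OpenPartialHomeomorph.subtypeRestr_mem_maximalAtlas_opens
    [IsManifold 𝓘(ℂ, Fin d → ℂ) ω X] {U : Opens X} (hU : Nonempty U)
    {e : OpenPartialHomeomorph X (Fin d → ℂ)}
    (he : e ∈ IsManifold.maximalAtlas 𝓘(ℂ, Fin d → ℂ) ω X) :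
    e.subtypeRestr hU ∈ IsManifold.maximalAtlas 𝓘(ℂ, Fin d → ℂ) ω U := by
  intro e' he'
  obtain ⟨x, rfl⟩ := Opens.chart_eq hU he'
  have hx : chartAt (Fin d → ℂ) x.1 ∈ IsManifold.maximalAtlas 𝓘(ℂ, Fin d → ℂ) ω X :=
    IsManifold.chart_mem_maximalAtlas x.1
  have key : ∀ e₁ e₂ : OpenPartialHomeomorph X (Fin d → ℂ),
      e₁ ∈ IsManifold.maximalAtlas 𝓘(ℂ, Fin d → ℂ) ω X →
      e₂ ∈ IsManifold.maximalAtlas 𝓘(ℂ, Fin d → ℂ) ω X →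
      (e₁.subtypeRestr hU).symm.trans (e₂.subtypeRestr hU)
        ∈ contDiffGroupoid ω 𝓘(ℂ, Fin d → ℂ) := fun e₁ e₂ h₁ h₂ =>
    StructureGroupoid.mem_of_eqOnSource _
      (closedUnderRestriction' (StructureGroupoid.compatible_of_mem_maximalAtlas h₁ h₂)
        (e₁.isOpen_inter_preimage_symm U.2)) (e₁.subtypeRestr_symm_trans_subtypeRestr hU e₂)
  exact ⟨key _ _ he hx, key _ _ hx he⟩

theorem IsNormalCrossingChart.opens [IsManifold 𝓘(ℂ, Fin d → ℂ) ω X] {U : Opens X} {π : X → ℂ}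
    {p : U} {k : ℕ} {e : OpenPartialHomeomorph X (Fin d → ℂ)}
    (h : IsNormalCrossingChart π p.1 k e) :
    IsNormalCrossingChart (fun x : U => π x) p k (e.subtypeRestr ⟨p⟩) where
  mem_maximalAtlas :=
    OpenPartialHomeomorph.subtypeRestr_mem_maximalAtlas_opens _ h.mem_maximalAtlas
  mem_source := by
    rw [OpenPartialHomeomorph.subtypeRestr_source]
    exact h.mem_source
  centred := h.centred
  one_le := h.one_le
  le_dim := h.le_dim
  eq_prod x hx := by
    rw [OpenPartialHomeomorph.subtypeRestr_source] at hx
    exact h.eq_prod x.1 hx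

theorem IsRealNormalCrossingChart.opens [IsManifold 𝓘(ℂ, Fin d → ℂ) ω X] {U : Opens X} {π : X → ℂ}
    {ι : X → X} {ι' : U → U} (hι : ∀ x, (ι' x).1 = ι x.1)
    {p : U} {k : ℕ} {e : OpenPartialHomeomorph X (Fin d → ℂ)}
    (h : IsRealNormalCrossingChart π ι p.1 k e) :
    IsRealNormalCrossingChart (fun x : U => π x) ι' p k (e.subtypeRestr ⟨p⟩) where
  toIsNormalCrossingChart := h.toIsNormalCrossingChart.opens
  conj_eq hp := by
    have h1 : ι p.1 = p.1 := by rw [← hι, hp]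
    filter_upwards [continuous_subtype_val.continuousAt.eventually (h.conj_eq h1)] with x hx i
    have h2 := hx i
    rw [← hι] at h2
    exact h2

theorem IsSemistableDegeneration.opens {π : X → ℂ} (h : IsSemistableDegeneration d Set.univ π)
    {U : Opens X} {B : Set ℂ} (hU : ∀ x, x ∈ U ↔ π x ∈ B) :
    IsSemistableDegeneration d B (fun x : U => π x) where
  isComplexManifold := h.isComplexManifold.opens U
  mapsTo x := (hU x.1).1 x.2
  holomorphic := h.holomorphic.comp contMDiff_subtype_val
  proper K hKB hK := by
    rw [Subtype.isCompact_iff]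
    -- As `K ⊆ B`, the whole preimage of `K` already lies in `U`.
    convert h.proper K (Set.subset_univ K) hK using 1
    ext x
    constructor
    · rintro ⟨y, hy, rfl⟩
      exact hy
    · intro hx
      exact ⟨⟨x, (hU x).2 (hKB hx)⟩, hx, rfl⟩
  regular x hx := by
    have h1 := h.holomorphic.mdifferentiable (by simp) x.1
    rw [h1.hasMFDerivAt.comp_opens_val.mfderiv]
    exact h.regular x.1 hx
  normalCrossing p hp := by
    have := h.isComplexManifold.isManifold
    obtain ⟨k, e, he⟩ := h.normalCrossing p.1 hp
    exact ⟨k, _, he.opens⟩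

theorem IsRealStructure.opens {π : X → ℂ} {ι : X → X} (h : IsRealStructure d π ι)
    {U : Opens X} {ι' : U → U} (hι : ∀ x, (ι' x).1 = ι x.1) :
    IsRealStructure d (fun x : U => π x) ι' where
  antiholomorphic := by
    refine ⟨?_, fun p => ?_⟩
    · rw [continuous_induced_rng]
      exact (h.antiholomorphic.1.comp continuous_subtype_val).congr fun x => (hι x).symm
    · have h1 := h.antiholomorphic.2 p.1
      rw [← contMDiffAt_subtype_iff, ← hι p] at h1
      refine h1.congr_of_eventuallyEq (Filter.Eventually.of_forall fun x => ?_)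
      funext i
      simp only [← hι]
      rfl
  involutive x := Subtype.ext (by rw [hι, hι, h.involutive])
  conj_comp x := by
    rw [hι]
    exact h.conj_comp x.1

/-- One real chart at each point decides the condition for all normal crossing charts there. -/
theorem IsSemistableDegeneration.isTotallyReal {B : Set ℂ} {π : X → ℂ} {ι : X → X}
    (h : IsSemistableDegeneration d B π) (hι : IsRealStructure d π ι)
    (hc : ∀ p, π p = 0 → ∃ (k : ℕ) (e : OpenPartialHomeomorph X (Fin d → ℂ)),
      IsRealNormalCrossingChart π ι p k e) :
    IsTotallyRealSemistableDegeneration d B π ι where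
  semistable := h
  realStructure := hι
  totallyReal p hp hιp k e he i hi := by
    obtain ⟨k', e', he'⟩ := hc p hp
    exact he'.image_coordHyperplane he hι.antiholomorphic.1 hι.involutive hιp hi

end Restrict

end

/-! ### Assembly over the plane and over the disc -/

theorem mainTheorem12 (n : ℕ) (S : PolyhedralSubdivision n) (hS : S.IsStronglyUnimodular) :
    ∃ _ : ChartedSpace (Fin (n + 1) → ℂ) S.ToricVariety,
      (∀ (f : S.ToricVariety → ℂ) (x : S.ToricVariety),
        ContMDiffAt 𝓘(ℂ, Fin (n + 1) → ℂ) 𝓘(ℂ, ℂ) ω f x ↔ S.IsToricHolomorphicAt f x) ∧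
      IsTotallyRealSemistableDegeneration (n + 1) Set.univ S.toricProj S.toricConj ∧
      IsTotallyRealSemistableDegeneration (n + 1) (Metric.ball 0 1)
        S.discProj S.discConj := by
  let B : ∀ τ : S.fan, ConeBasis τ.1 := fun τ => (hS.1 τ.1 τ.2).nonempty_coneBasis.some
  let _ := PolyhedralSubdivision.toricChartedSpace hS.1 B
  have hman := PolyhedralSubdivision.isManifold_toric hS.1 B
  refine ⟨PolyhedralSubdivision.toricChartedSpace hS.1 B,
    PolyhedralSubdivision.contMDiffAt_toric_iff hS.1 B, ?_⟩
  have hcharts := fun (p : S.ToricVariety) (hp : S.toricProj p = 0) =>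
    hS.exists_isRealNormalCrossingChart B hp
  have hss : IsSemistableDegeneration (n + 1) Set.univ S.toricProj :=
    { isComplexManifold := ⟨hman, hS.1.t2Space, hS.1.secondCountableTopology⟩
      mapsTo := fun x => Set.mem_univ _
      holomorphic := PolyhedralSubdivision.contMDiff_toricProj hS.1 B
      proper := fun K _ hK => hS.1.isCompact_preimage_toricProj hK
      regular := fun x hx => PolyhedralSubdivision.surjective_mfderiv_toricProj hS.1 B hx
      normalCrossing := fun p hp => by
        obtain ⟨k, e, he⟩ := hcharts p hp
        exact ⟨k, e, he.toIsNormalCrossingChart⟩ }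
  have hreal : IsRealStructure (n + 1) S.toricProj S.toricConj :=
    ⟨PolyhedralSubdivision.isAntiholomorphic_toricConj hS.1 B,
      PolyhedralSubdivision.involutive_toricConj, fun x => (S.toricProj_toricConj x).symm⟩
  refine ⟨hss.isTotallyReal hreal hcharts, ?_⟩
  refine (hss.opens (U := S.overDisc) fun x => Iff.rfl).isTotallyReal
    (hreal.opens (U := S.overDisc) fun x => rfl) fun p hp => ?_
  obtain ⟨k, e, he⟩ := hcharts p.1 hp
  exact ⟨k, _, he.opens fun x => rfl⟩
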